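/- Let $r,n\ge 0$ be integers, let $\sigma\in\mathbb C^\times$, let $\tau\in\mathbb C$ with $\operatorname{Im}\tau>0$, and put $q=e^{2\pi i\sigma}$, $p=e^{2\pi i\tau}$ (so $0<|p|<1$). Assume that $q^m\notin p^{\mathbb Z}$ for $1\le m\le n$. Write $$\theta(x)=\prod_{k\ge0}(1-xp^k)(1-p^{k+1}/x),\qquad (x;q,p)_m=\prod_{k=0}^{m-1}\theta(xq^k),\qquad \theta(x_1,\dots,x_m)=\theta(x_1)\cdots\theta(x_m).$$ Let $\mathbb E=\mathbb E_{a_1,\dots,a_r;q,p}$ be the field of meromorphic functions on $\mathbb C^r$ in the variables $u_i=\log_q a_i$ (that is, $a_i=e^{2\pi i\sigma u_i}$) which are periodic in each $u_i$ with periods $\sigma^{-1}$ and $\tau\sigma^{-1}$. Let $A=\mathbb C_{q,p}[X_1,\dots,X_r,\mathbb E]$ be the associative unital $\mathbb C$-algebra generated by $X_1,\dots,X_r$ and the commutative algebra $\mathbb E$, subject to the relations $$X_jX_i=\frac{\theta(a_iq^3,\,a_jq,\,a_iq^{-1}/a_j)}{\theta(a_iq,\,a_jq^3,\,a_iq/a_j)}\,q\;X_iX_j\qquad(1\le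 i<j\le r),$$ $$X_i\,f(a_1,\dots,a_r)=f(a_1q^2,\dots,a_{i-1}q^2,a_iq,a_{i+1}q^2,\dots,a_rq^2)\,X_i\qquad(1\le i\le r,\ f\in\mathbb E).$$ For non-negative integers $k_1,\dots,k_r$ put $K_i=k_1+\cdots+k_i$ and $$\begin{bmatrix}K_r\\k_1,\dots,k_r\end{bmatrix}_{a_1,\dots,a_r;q,p}=\frac{(q;q,p)_{K_r}}{\prod_{i=1}^r(q;q,p)_{k_i}}\prod_{i=1}^r\frac{(a_iq^{1+K_r-k_i};q,p)_{k_i}}{(a_iq^{1+2K_{i-1}};q,p)_{k_i}}\prod_{1\le i<j\le r}\frac{(a_iq^{1-k_i}/a_j;q,p)_{k_j}}{(a_iq/a_j;q,p)_{k_j}}.$$ Then these coefficients, for $k_1+\cdots+k_r=n$, belong to $\mathbb E$, and in $A$ $$(X_1+\cdots+X_r)^n=\sum_{\substack{k_1,\dots,k_r\ge0\\k_1+\cdots+k_r=n}}\begin{bmatrix}n\\k_1,\dots,k_r\end{bmatrix}_{a_1,\dots,a_r;q,p}X_1^{k_1}\cdots X_r^{k_r}.$$ Moreover, normal forms in $A$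 exist and are unique: every element of $A$ can be written in exactly one way as a finite sum $\sum_{k}f_k\,X_1^{k_1}\cdots X_r^{k_r}$ with $f_k\in\mathbb E$. -/

import Mathlib

open scoped UpperHalfPlane

namespace EllipticMultinomial

noncomputable section

/-! ### Base, nome and theta function

The base `q` and the nome `p` are written `q = exp (2πiσ)` and `p = exp (2πiτ)`, where `σ` is a
complex number and `τ` lies in the upper half plane (so that `0 < |p| < 1`). -/

/-- The base `q = exp (2πiσ)`. -/
def base (σ : ℂ) : ℂ := Complex.exp (2 * Real.pi * Complex.I * σ)

/-- The nome `p = exp (2πiτ)`. -/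
def nome (τ : ℍ) : ℂ := Complex.exp (2 * Real.pi * Complex.I * (τ : ℂ))

/-- The infinite shifted factorial `(x; p)_∞ = ∏_{k ≥ 0} (1 - x p ^ k)`. -/
def infFactorial (p x : ℂ) : ℂ := ∏' k : ℕ, (1 - x * p ^ k)

/-- The modified Jacobi theta function `θ(x; p) = (x; p)_∞ (p / x; p)_∞`. -/
def theta (p x : ℂ) : ℂ := infFactorial p x * infFactorial p (p / x)

theorem base_ne_zero (σ : ℂ) : base σ ≠ 0 := Complex.exp_ne_zero _

theorem nome_ne_zero (τ : ℍ) : nome τ ≠ 0 := Complex.exp_ne_zero _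

theorem norm_nome_lt_one (τ : ℍ) : ‖nome τ‖ < 1 :=
  UpperHalfPlane.norm_exp_two_pi_I_lt_one τ

theorem infFactorial_eq_mul {p : ℂ} (hp : ‖p‖ < 1) (x : ℂ) :
    infFactorial p x = (1 - x) * infFactorial p (p * x) := by
  have hm : Multipliable fun k : ℕ => 1 - x * p ^ (k + 1) := by
    have h : Summable fun k : ℕ => ‖-(x * p ^ (k + 1))‖ := by
      simp only [norm_neg, norm_mul, norm_pow, pow_succ]
      exact ((summable_geometric_of_lt_one (norm_nonneg _) hp).mul_right _).mul_left _
    simpa [sub_eq_add_neg] using multipliable_one_add_of_summable h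
  have h0 := tprod_eq_zero_mul' (f := fun k : ℕ => 1 - x * p ^ k) hm
  have h1 : ∏' k : ℕ, (1 - x * p ^ (k + 1)) = ∏' k : ℕ, (1 - p * x * p ^ k) :=
    tprod_congr fun k => by ring
  rw [pow_zero, mul_one, h1] at h0
  exact h0

/-- Quasi-periodicity of the theta function. -/
theorem theta_nome_mul {p : ℂ} (hp0 : p ≠ 0) (hp : ‖p‖ < 1) {x : ℂ} (hx : x ≠ 0) :
    theta p (p * x) = -x⁻¹ * theta p x := by
  have h1 : p / (p * x) = x⁻¹ := by field_simp
  have h2 : p * x⁻¹ = p / x := rfl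
  unfold theta
  rw [h1, infFactorial_eq_mul hp x, infFactorial_eq_mul hp x⁻¹, h2]
  field_simp
  ring

theorem differentiable_infFactorial {p : ℂ} (hp : ‖p‖ < 1) :
    Differentiable ℂ (infFactorial p) := by
  intro x₀
  have hR : x₀ ∈ Metric.ball (0 : ℂ) (‖x₀‖ + 1) := by simp
  have key : HasProdLocallyUniformlyOn (fun (k : ℕ) (x : ℂ) => 1 + -(x * p ^ k))
      (fun x => ∏' k : ℕ, (1 + -(x * p ^ k))) (Metric.ball (0 : ℂ) (‖x₀‖ + 1)) := by
    refine Summable.hasProdLocallyUniformlyOn_nat_one_add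
      (u := fun k => (‖x₀‖ + 1) * ‖p‖ ^ k) Metric.isOpen_ball
      ((summable_geometric_of_lt_one (norm_nonneg _) hp).mul_left _)
      (Filter.Eventually.of_forall fun k x hx => ?_) (fun k => by fun_prop)
    rw [norm_neg, norm_mul, norm_pow]
    have : ‖x‖ ≤ ‖x₀‖ + 1 := by simpa using (mem_ball_zero_iff.1 hx).le
    gcongr
  have hd := (hasProdLocallyUniformlyOn_iff_tendstoLocallyUniformlyOn.1 key).differentiableOn
    (Filter.Eventually.of_forall fun s => by fun_prop) Metric.isOpen_ball
  have := hd.differentiableAt (Metric.isOpen_ball.mem_nhds hR)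
  refine this.congr_of_eventuallyEq (Filter.Eventually.of_forall fun x => ?_)
  simp [infFactorial, sub_eq_add_neg]

theorem analyticAt_apply {r : ℕ} (i : Fin r) (u : Fin r → ℂ) :
    AnalyticAt ℂ (fun u : Fin r → ℂ => u i) u :=
  (ContinuousLinearMap.proj (R := ℂ) (φ := fun _ : Fin r => ℂ) i).analyticAt u

theorem analyticAt_theta {p : ℂ} (hp : ‖p‖ < 1) {x : ℂ} (hx : x ≠ 0) :
    AnalyticAt ℂ (theta p) x := by
  have h1 (y : ℂ) : AnalyticAt ℂ (infFactorial p) y :=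
    (differentiable_infFactorial hp).analyticAt y
  have h2 : AnalyticAt ℂ (fun y : ℂ => p / y) x := analyticAt_const.div analyticAt_id hx
  exact (h1 x).mul ((h1 (p / x)).comp h2)

/-! ### Holomorphic and meromorphic functions on `ℂ ^ r` -/

/-- The ring of entire functions of `r` complex variables `u = (u_1, …, u_r)`. -/
def Hol (r : ℕ) : Subalgebra ℂ ((Fin r → ℂ) → ℂ) where
  carrier := {f | AnalyticOnNhd ℂ f Set.univ}
  mul_mem' hf hg := AnalyticOnNhd.mul hf hg
  add_mem' hf hg := AnalyticOnNhd.add hf hg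
  algebraMap_mem' _ := analyticOnNhd_const

instance (r : ℕ) : IsDomain (Hol r) := by
  have : NoZeroDivisors (Hol r) := ⟨by
    rintro ⟨f, hf⟩ ⟨g, hg⟩ h
    by_contra! hne
    obtain ⟨x, hx⟩ : ∃ x, f x ≠ 0 := by
      by_contra! h0
      exact hne.1 (Subtype.ext (funext h0))
    refine hne.2 (Subtype.ext ?_)
    have hz : g =ᶠ[nhds x] 0 := by
      filter_upwards [(hf x trivial).continuousAt.eventually_ne hx] with y hy
      have : f y * g y = 0 := congrFun (congrArg Subtype.val h) y
      exact (mul_eq_zero.1 this).resolve_left hy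
    exact funext fun y => AnalyticOnNhd.eqOn_zero_of_preconnected_of_eventuallyEq_zero hg
      isPreconnected_univ (Set.mem_univ x) hz (Set.mem_univ y)⟩
  exact NoZeroDivisors.to_isDomain _

/-- The field of meromorphic functions on `ℂ ^ r`: on `ℂ ^ r` every such function is a
quotient of two entire functions, so this is the field of fractions of the ring of entire
functions. -/
def Mer (r : ℕ) : Type := FractionRing (Hol r)

instance (r : ℕ) : Field (Mer r) := inferInstanceAs (Field (FractionRing (Hol r)))

instance (r : ℕ) : Algebra (Hol r) (Mer r) :=
  inferInstanceAs (Algebra (Hol r) (FractionRing (Hol r)))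

instance (r : ℕ) : Algebra ℂ (Mer r) := inferInstanceAs (Algebra ℂ (FractionRing (Hol r)))

instance (r : ℕ) : IsScalarTower ℂ (Hol r) (Mer r) :=
  IsScalarTower.of_algebraMap_eq fun _ => rfl

instance (r : ℕ) : IsFractionRing (Hol r) (Mer r) :=
  inferInstanceAs (IsFractionRing (Hol r) (FractionRing (Hol r)))

/-- Translation `f(u) ↦ f(u + v)` of entire functions. -/
def translateHol {r : ℕ} (v : Fin r → ℂ) : Hol r ≃ₐ[ℂ] Hol r where
  toFun f := ⟨fun u => f.1 (u + v), fun u _ =>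
    (f.2 (u + v) trivial).comp (f := fun u => u + v) (analyticAt_id.add analyticAt_const)⟩
  invFun f := ⟨fun u => f.1 (u - v), fun u _ =>
    (f.2 (u - v) trivial).comp (f := fun u => u - v) (analyticAt_id.sub analyticAt_const)⟩
  left_inv f := Subtype.ext (funext fun u => by simp)
  right_inv f := Subtype.ext (funext fun u => by simp)
  map_mul' _ _ := rfl
  map_add' _ _ := rfl
  commutes' _ := rfl

/-- Translation `f(u) ↦ f(u + v)` of meromorphic functions. -/
def translate {r : ℕ} (v : Fin r → ℂ) : Mer r ≃ₐ[ℂ] Mer r :=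
  IsFractionRing.algEquivOfAlgEquiv (translateHol v)

theorem translate_algebraMap {r : ℕ} (v : Fin r → ℂ) (f : Hol r) :
    translate v (algebraMap (Hol r) (Mer r) f) = algebraMap (Hol r) (Mer r) (translateHol v f) :=
  IsFractionRing.algEquivOfAlgEquiv_algebraMap _ _

theorem translate_translate {r : ℕ} (v w : Fin r → ℂ) (f : Mer r) :
    translate v (translate w f) = translate (v + w) f := by
  obtain ⟨g, h, -, rfl⟩ := IsFractionRing.div_surjective (A := Hol r) f
  have (k : Hol r) : translateHol v (translateHol w k) = translateHol (v + w) k :=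
    Subtype.ext (funext fun u => congrArg k.1 (add_assoc u v w))
  simp only [map_div₀, translate_algebraMap, this]

/-- The field of totally elliptic functions: the meromorphic functions of
`u_i = log_q a_i`, `1 ≤ i ≤ r`, which in each variable have the two periods `σ⁻¹` and `τ σ⁻¹`. -/
def TotallyElliptic (r : ℕ) (σ : ℂ) (τ : ℍ) : IntermediateField ℂ (Mer r) where
  carrier := {f | ∀ i, translate (Pi.single i σ⁻¹) f = f ∧
    translate (Pi.single i ((τ : ℂ) * σ⁻¹)) f = f}
  mul_mem' hf hg i := by
    simp only [map_mul, (hf i).1, (hg i).1, (hf i).2, (hg i).2, and_self]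
  add_mem' hf hg i := by
    simp only [map_add, (hf i).1, (hg i).1, (hf i).2, (hg i).2, and_self]
  algebraMap_mem' c i := by simp only [AlgEquiv.commutes, and_self]
  inv_mem' f hf i := by simp only [map_inv₀, (hf i).1, (hf i).2, and_self]

theorem translate_mem {r : ℕ} {σ : ℂ} {τ : ℍ} (v : Fin r → ℂ) {f : Mer r}
    (hf : f ∈ TotallyElliptic r σ τ) : translate v f ∈ TotallyElliptic r σ τ := by
  intro i
  constructor
  · rw [translate_translate, add_comm, ← translate_translate, (hf i).1]
  · rw [translate_translate, add_comm, ← translate_translate, (hf i).2]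

/-- The automorphism `f(a_1, …, a_r) ↦ f(a_1 q², …, a_{i-1} q², a_i q, a_{i+1} q², …, a_r q²)` of
the field of totally elliptic functions; in the variables `u_j = log_q a_j` it is a translation. -/
def shift {r : ℕ} {σ : ℂ} {τ : ℍ} (i : Fin r) (f : TotallyElliptic r σ τ) :
    TotallyElliptic r σ τ :=
  ⟨translate (fun j => if j = i then 1 else 2) f.1, translate_mem _ f.2⟩

/-! ### Theta functions and elliptic weights in the variables `a_i` -/

/-- The variable `a_i = q ^ {u_i} = exp (2πiσ u_i)`, a nowhere vanishing entire function. -/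
def var {r : ℕ} (σ : ℂ) (i : Fin r) : (Hol r)ˣ where
  val := ⟨fun u => Complex.exp (2 * Real.pi * Complex.I * σ * u i), fun u _ =>
    (analyticAt_const.mul (analyticAt_apply i u)).cexp⟩
  inv := ⟨fun u => Complex.exp (-(2 * Real.pi * Complex.I * σ * u i)), fun u _ =>
    (analyticAt_const.mul (analyticAt_apply i u)).neg.cexp⟩
  val_inv := Subtype.ext (funext fun u => by simp [← Complex.exp_add])
  inv_val := Subtype.ext (funext fun u => by simp [← Complex.exp_add])

/-- A nonzero complex number, as a constant function. -/
def const {r : ℕ} (c : ℂˣ) : (Hol r)ˣ := Units.map (algebraMap ℂ (Hol r)).toMonoidHom c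

/-- The base `q`, as a constant function. -/
def qC (r : ℕ) (σ : ℂ) : (Hol r)ˣ := const (Units.mk0 (base σ) (base_ne_zero σ))

theorem unit_apply_ne_zero {r : ℕ} (x : (Hol r)ˣ) (u : Fin r → ℂ) : x.1.1 u ≠ 0 := by
  intro h
  have h1 : x.1.1 u * (x⁻¹).1.1 u = 1 := congrFun (congrArg Subtype.val x.mul_inv) u
  simp [h] at h1

/-- The entire function `u ↦ θ(x(u); p)`, for a nowhere vanishing entire function `x`. -/
def thetaHol {r : ℕ} (τ : ℍ) (x : (Hol r)ˣ) : Hol r :=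
  ⟨fun u => theta (nome τ) (x.1.1 u), fun u _ =>
    (analyticAt_theta (norm_nome_lt_one τ) (unit_apply_ne_zero x u)).comp (x.1.2 u trivial)⟩

/-- `θ(x; p)` as an element of the field of meromorphic functions. -/
def th {r : ℕ} (τ : ℍ) (x : (Hol r)ˣ) : Mer r := algebraMap (Hol r) (Mer r) (thetaHol τ x)

/-- The theta shifted factorial `(x; q, p)_n = ∏_{k=0}^{n-1} θ(x q ^ k; p)`. -/
def thetaFactorial {r : ℕ} (σ : ℂ) (τ : ℍ) (x : (Hol r)ˣ) (n : ℕ) : Mer r :=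
  ∏ k ∈ Finset.range n, th τ (x * qC r σ ^ k)

/-- The small elliptic weight `w_{a,b;q,p}(s,t)`. -/
def smallWeight {r : ℕ} (σ : ℂ) (τ : ℍ) (a b : (Hol r)ˣ) (s t : ℤ) : Mer r :=
  (th τ (a * qC r σ ^ (s + 2 * t)) * th τ (b * qC r σ ^ (2 * s + t - 2)) *
      th τ (a * qC r σ ^ (t - s - 1) / b)) /
    (th τ (a * qC r σ ^ (s + 2 * t - 2)) * th τ (b * qC r σ ^ (2 * s + t)) *
      th τ (a * qC r σ ^ (t - s + 1) / b)) *
    algebraMap ℂ (Mer r) (base σ)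

/-- The elliptic multinomial coefficient
`[k_1 + ⋯ + k_r; k_1, …, k_r]_{a_1, …, a_r; q, p}`. In the exponents,
`∑ ν, k ν` is `K_r` and `∑ ν with ν < i, k ν` is `K_{i-1}`. -/
def ellMultinomial {r : ℕ} (σ : ℂ) (τ : ℍ) (k : Fin r → ℕ) : Mer r :=
  thetaFactorial σ τ (qC r σ) (∑ ν, k ν) / (∏ i, thetaFactorial σ τ (qC r σ) (k i)) *
    (∏ i, thetaFactorial σ τ (var σ i * qC r σ ^ (1 + (∑ ν, (k ν : ℤ)) - k i)) (k i) /
      thetaFactorial σ τ (var σ i * qC r σ ^ (1 + 2 * ∑ ν with ν < i, (k ν : ℤ))) (k i)) *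
    ∏ i, ∏ j with i < j,
      thetaFactorial σ τ (var σ i * qC r σ ^ (1 - (k i : ℤ)) / var σ j) (k j) /
        thetaFactorial σ τ (var σ i * qC r σ / var σ j) (k j)

/-! ### Ellipticity of the weights -/

/-- The action of a translation on units. -/
def translateUnit {r : ℕ} (v : Fin r → ℂ) : (Hol r)ˣ →* (Hol r)ˣ :=
  Units.map (translateHol v : Hol r →* Hol r)

theorem translate_th {r : ℕ} (τ : ℍ) (v : Fin r → ℂ) (x : (Hol r)ˣ) :
    translate v (th τ x) = th τ (translateUnit v x) :=
  translate_algebraMap _ _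

theorem translateUnit_qC {r : ℕ} (σ : ℂ) (v : Fin r → ℂ) :
    translateUnit v (qC r σ) = qC r σ := rfl

/-- The nome `p`, as a constant function. -/
def pC (r : ℕ) (τ : ℍ) : (Hol r)ˣ := const (Units.mk0 (nome τ) (nome_ne_zero τ))

theorem translateUnit_var_one {r : ℕ} {σ : ℂ} (hσ : σ ≠ 0) (l i : Fin r) :
    translateUnit (Pi.single l σ⁻¹) (var σ i) = var σ i := by
  refine Units.ext (Subtype.ext (funext fun u => ?_))
  change Complex.exp (2 * Real.pi * Complex.I * σ * (u + Pi.single l σ⁻¹ : Fin r → ℂ) i) =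
    Complex.exp (2 * Real.pi * Complex.I * σ * u i)
  by_cases h : i = l
  · subst h
    rw [Pi.add_apply, Pi.single_eq_same,
      show 2 * Real.pi * Complex.I * σ * (u i + σ⁻¹) =
        2 * Real.pi * Complex.I * σ * u i + 2 * Real.pi * Complex.I by field_simp,
      Complex.exp_periodic]
  · rw [Pi.add_apply, Pi.single_eq_of_ne h, add_zero]

theorem translateUnit_var_nome {r : ℕ} {σ : ℂ} (hσ : σ ≠ 0) (τ : ℍ) (l i : Fin r) :
    translateUnit (Pi.single l ((τ : ℂ) * σ⁻¹)) (var σ i) =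
      if i = l then pC r τ * var σ i else var σ i := by
  refine Units.ext (Subtype.ext (funext fun u => ?_))
  change Complex.exp (2 * Real.pi * Complex.I * σ * (u + Pi.single l ((τ : ℂ) * σ⁻¹) : Fin r → ℂ) i) = _
  split_ifs with h
  · subst h
    change _ = nome τ * Complex.exp (2 * Real.pi * Complex.I * σ * u i)
    rw [nome, ← Complex.exp_add, Pi.add_apply, Pi.single_eq_same]
    congr 1
    field_simp
    ring
  · rw [Pi.add_apply, Pi.single_eq_of_ne h, add_zero]
    rfl

/-- A nowhere vanishing entire function, as a nonzero element of the field of meromorphic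
functions. -/
def toMer {r : ℕ} : (Hol r)ˣ →* (Mer r)ˣ := Units.map (algebraMap (Hol r) (Mer r)).toMonoidHom

theorem th_nome_mul {r : ℕ} (τ : ℍ) (x : (Hol r)ˣ) :
    th τ (pC r τ * x) = -((toMer x : (Mer r)ˣ) : Mer r)⁻¹ * th τ x := by
  have h : (x : Hol r) * thetaHol τ (pC r τ * x) = -thetaHol τ x := by
    refine Subtype.ext (funext fun u => ?_)
    change x.1.1 u * theta (nome τ) (nome τ * x.1.1 u) = -theta (nome τ) (x.1.1 u)
    have hx := unit_apply_ne_zero x u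
    rw [theta_nome_mul (nome_ne_zero τ) (norm_nome_lt_one τ) hx]
    field_simp
  have h' : ((toMer x : (Mer r)ˣ) : Mer r) * th τ (pC r τ * x) = -th τ x := by
    have h' := congrArg (algebraMap (Hol r) (Mer r)) h
    rwa [map_mul, map_neg] at h'
  have hx := (toMer x).ne_zero
  field_simp
  linear_combination h'

theorem th_div_nome {r : ℕ} (τ : ℍ) (x : (Hol r)ˣ) :
    th τ (x / pC r τ) = -((toMer (x / pC r τ) : (Mer r)ˣ) : Mer r) * th τ x := by
  have h := th_nome_mul τ (x / pC r τ)
  rw [mul_div_cancel] at h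
  have hx := (toMer (x / pC r τ)).ne_zero
  rw [h]
  field_simp

theorem smallWeight_nome_mul_left {r : ℕ} (σ : ℂ) (τ : ℍ) (a b : (Hol r)ˣ) (s t : ℤ) :
    smallWeight σ τ (pC r τ * a) b s t = smallWeight σ τ a b s t := by
  unfold smallWeight
  simp only [mul_assoc (pC r τ), mul_div_assoc (pC r τ), th_nome_mul]
  simp only [map_mul, map_div, map_zpow, Units.val_mul, Units.val_div_eq_div_val,
    Units.val_zpow_eq_zpow_val]
  have ha := (toMer a).ne_zero
  have hb := (toMer b).ne_zero
  have hq := (toMer (qC r σ)).ne_zero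
  generalize ((toMer a : (Mer r)ˣ) : Mer r) = A at *
  generalize ((toMer b : (Mer r)ˣ) : Mer r) = B at *
  generalize ((toMer (qC r σ) : (Mer r)ˣ) : Mer r) = Q at *
  have hc : (-(A * Q ^ (s + 2 * t))⁻¹) * (-(A * Q ^ (t - s - 1) / B)⁻¹) =
      (-(A * Q ^ (s + 2 * t - 2))⁻¹) * (-(A * Q ^ (t - s + 1) / B)⁻¹) := by
    have : Q ^ (s + 2 * t) * Q ^ (t - s - 1) = Q ^ (s + 2 * t - 2) * Q ^ (t - s + 1) := by
      rw [← zpow_add₀ hq, ← zpow_add₀ hq]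
      congr 1
      ring
    field_simp
    linear_combination (-1 : Mer r) * this
  have hc0 : (-(A * Q ^ (s + 2 * t - 2))⁻¹) * (-(A * Q ^ (t - s + 1) / B)⁻¹) ≠ 0 := by
    simp [ha, hb, zpow_ne_zero _ hq]
  congr 1
  symm
  rw [← mul_div_mul_left _ _ hc0]
  congr 1
  · rw [← hc]
    ring
  · ring

theorem smallWeight_nome_mul_right {r : ℕ} (σ : ℂ) (τ : ℍ) (a b : (Hol r)ˣ) (s t : ℤ) :
    smallWeight σ τ a (pC r τ * b) s t = smallWeight σ τ a b s t := by
  unfold smallWeight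
  have hd (m : ℤ) : a * qC r σ ^ m / (pC r τ * b) = (a * qC r σ ^ m / b) / pC r τ := by
    rw [div_div, mul_comm b]
  simp only [hd, mul_assoc (pC r τ), th_nome_mul, th_div_nome]
  simp only [map_mul, map_div, map_zpow, Units.val_mul, Units.val_div_eq_div_val,
    Units.val_zpow_eq_zpow_val]
  have ha := (toMer a).ne_zero
  have hb := (toMer b).ne_zero
  have hq := (toMer (qC r σ)).ne_zero
  have hp := (toMer (pC r τ)).ne_zero
  generalize ((toMer a : (Mer r)ˣ) : Mer r) = A at *
  generalize ((toMer b : (Mer r)ˣ) : Mer r) = B at *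
  generalize ((toMer (qC r σ) : (Mer r)ˣ) : Mer r) = Q at *
  generalize ((toMer (pC r τ) : (Mer r)ˣ) : Mer r) = P at *
  have hc : (-(B * Q ^ (2 * s + t - 2))⁻¹) * (-(A * Q ^ (t - s - 1) / B / P)) =
      (-(B * Q ^ (2 * s + t))⁻¹) * (-(A * Q ^ (t - s + 1) / B / P)) := by
    have : Q ^ (t - s - 1) * Q ^ (2 * s + t) = Q ^ (t - s + 1) * Q ^ (2 * s + t - 2) := by
      rw [← zpow_add₀ hq, ← zpow_add₀ hq]
      congr 1
      ring
    field_simp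
    linear_combination this
  have hc0 : (-(B * Q ^ (2 * s + t))⁻¹) * (-(A * Q ^ (t - s + 1) / B / P)) ≠ 0 := by
    simp [ha, hb, hp, zpow_ne_zero _ hq]
  congr 1
  symm
  rw [← mul_div_mul_left _ _ hc0]
  congr 1
  · rw [← hc]
    ring
  · ring

theorem translate_smallWeight {r : ℕ} (σ : ℂ) (τ : ℍ) (v : Fin r → ℂ) (a b : (Hol r)ˣ)
    (s t : ℤ) : translate v (smallWeight σ τ a b s t) =
      smallWeight σ τ (translateUnit v a) (translateUnit v b) s t := by
  simp only [smallWeight, map_mul, map_div₀, AlgEquiv.commutes, translate_th, map_div, map_zpow,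
    translateUnit_qC]

theorem smallWeight_mem {r : ℕ} {σ : ℂ} (hσ : σ ≠ 0) (τ : ℍ) (i j : Fin r) (s t : ℤ) :
    smallWeight σ τ (var σ i) (var σ j) s t ∈ TotallyElliptic r σ τ := by
  intro l
  constructor
  · rw [translate_smallWeight, translateUnit_var_one hσ, translateUnit_var_one hσ]
  · rw [translate_smallWeight, translateUnit_var_nome hσ, translateUnit_var_nome hσ]
    split_ifs <;> simp only [smallWeight_nome_mul_left, smallWeight_nome_mul_right]

/-- The small elliptic weight `w_{a_i,a_j;q,p}(s,t)`, as a totally elliptic function. -/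
def weight {r : ℕ} {σ : ℂ} (hσ : σ ≠ 0) (τ : ℍ) (i j : Fin r) (s t : ℤ) :
    TotallyElliptic r σ τ :=
  ⟨smallWeight σ τ (var σ i) (var σ j) s t, smallWeight_mem hσ τ i j s t⟩

/-! ### The algebra of elliptic-commuting variables -/

/-- The free algebra on the generators `X_1, …, X_r` and the elements of the field of totally
elliptic functions. -/
abbrev Free (r : ℕ) (σ : ℂ) (τ : ℍ) : Type := FreeAlgebra ℂ (Fin r ⊕ TotallyElliptic r σ τ)

/-- The generator `X_i` of the free algebra. -/
def Free.X {r : ℕ} {σ : ℂ} {τ : ℍ} (i : Fin r) : Free r σ τ := FreeAlgebra.ι ℂ (Sum.inl i)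

/-- The generator of the free algebra which corresponds to a totally elliptic function. -/
def Free.C {r : ℕ} {σ : ℂ} {τ : ℍ} (f : TotallyElliptic r σ τ) : Free r σ τ :=
  FreeAlgebra.ι ℂ (Sum.inr f)

/-- The defining relations: the totally elliptic functions form a subalgebra, and the two families
of commutation relations. -/
inductive Rel {r : ℕ} {σ : ℂ} (hσ : σ ≠ 0) (τ : ℍ) : Free r σ τ → Free r σ τ → Prop
  | add (f g : TotallyElliptic r σ τ) : Rel hσ τ (Free.C (f + g)) (Free.C f + Free.C g)
  | mul (f g : TotallyElliptic r σ τ) : Rel hσ τ (Free.C (f * g)) (Free.C f * Free.C g)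
  | scalar (c : ℂ) : Rel hσ τ (Free.C (algebraMap ℂ _ c)) (algebraMap ℂ _ c)
  | comm (i j : Fin r) (h : i < j) :
      Rel hσ τ (Free.X j * Free.X i) (Free.C (weight hσ τ i j 1 1) * Free.X i * Free.X j)
  | shift (i : Fin r) (f : TotallyElliptic r σ τ) :
      Rel hσ τ (Free.X i * Free.C f) (Free.C (shift i f) * Free.X i)

/-- The algebra `ℂ_{q,p}[X_1, …, X_r, E_{a_1, …, a_r; q, p}]` of elliptic-commuting variables. -/
abbrev EllAlgebra (r : ℕ) {σ : ℂ} (hσ : σ ≠ 0) (τ : ℍ) : Type := RingQuot (Rel (r := r) hσ τ)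

/-- The variable `X_i` of the algebra of elliptic-commuting variables. -/
def X {r : ℕ} {σ : ℂ} (hσ : σ ≠ 0) (τ : ℍ) (i : Fin r) : EllAlgebra r hσ τ :=
  RingQuot.mkAlgHom ℂ (Rel hσ τ) (Free.X i)

/-- The totally elliptic functions inside the algebra of elliptic-commuting variables. -/
def C {r : ℕ} {σ : ℂ} (hσ : σ ≠ 0) (τ : ℍ) : TotallyElliptic r σ τ →ₐ[ℂ] EllAlgebra r hσ τ :=
  have hs (c : ℂ) : RingQuot.mkAlgHom ℂ (Rel (r := r) hσ τ) (Free.C (algebraMap ℂ _ c)) =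
      algebraMap ℂ _ c := by
    rw [RingQuot.mkAlgHom_rel ℂ (Rel.scalar c), AlgHom.commutes]
  { toFun := fun f => RingQuot.mkAlgHom ℂ (Rel hσ τ) (Free.C f)
    map_one' := by simpa only [map_one] using hs 1
    map_zero' := by simpa only [map_zero] using hs 0
    map_mul' := fun f g => by rw [RingQuot.mkAlgHom_rel ℂ (Rel.mul f g), map_mul]
    map_add' := fun f g => by rw [RingQuot.mkAlgHom_rel ℂ (Rel.add f g), map_add]
    commutes' := hs }

/-- The ordered monomial `X_1 ^ {k_1} ⋯ X_r ^ {k_r}`. -/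
def monomial {r : ℕ} {σ : ℂ} (hσ : σ ≠ 0) (τ : ℍ) (k : Fin r → ℕ) : EllAlgebra r hσ τ :=
  (List.ofFn fun i => X hσ τ i ^ k i).prod

end

end EllipticMultinomial

/-!
The algebra of elliptic-commuting variables acts by difference operators, and in this action both
assertions become identities between theta functions.

Let `T_i` be the translation `a_i ↦ a_i q`, `a_j ↦ a_j q²` (`j ≠ i`) of the field of all meromorphic
functions. The operators `θ(a_i q) / ∏_{j ≠ i} θ(a_i / a_j) · T_i` satisfy the defining relations of
the algebra (`opCoeff_mul_shiftMer`), and so the algebra acts on the functions from exponent vectors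
to meromorphic functions, the exponent vector recording how often each `X_i` has been applied
(`rep`). On the constant `1` an ordered monomial acts by a nonzero function, which is an explicit
product of theta functions (`rep_monomial`, `monomialCoeff_ne_zero`). Hence the coefficients of a
normal form can be recovered from the action, and normal forms are unique
(`normal_form_injective`). They exist because the relations allow one to move every variable to its
place (`exists_normal_form`).

The multinomial coefficients times the functions of the ordered monomials are again explicit
products, `powerCoeff`. That `(∑ X_i) ^ n` acts by these products (`rep_sum_pow`) is proved by
induction on `n`. The induction step states that certain quotients of theta functions add up to
`1` (`sum_recursionWeight`); this is a case of the elliptic partial fraction expansion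
(`prod_th_div_eq_sum`), which follows from the three-term identity `th_three_term` by induction on
the number of poles. The three-term identity itself is a consequence of Liouville's theorem: the
quotient of suitable products of theta functions is an entire elliptic function
(`oddTheta_three_term_generic`). The assumption on `q` is needed for `θ(q ^ m) ≠ 0` with
`1 ≤ m ≤ n`.

No separate verification is needed that the multinomial coefficients are totally elliptic: the
normal form of `(∑ X_i) ^ n` has totally elliptic coefficients by construction, and comparison of
the actions on `1` shows that these are the multinomial coefficients.
-/

namespace EllipticMultinomial

/-! ### The theta function as a function of one complex variable -/

theorem infFactorial_ne_zero {p : ℂ} (hp : ‖p‖ < 1) {x : ℂ} (h : ∀ k : ℕ, x * p ^ k ≠ 1) :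
    infFactorial p x ≠ 0 := by
  have hs : Summable fun k : ℕ => ‖-(x * p ^ k)‖ := by
    simp only [norm_neg, norm_mul, norm_pow]
    exact (summable_geometric_of_lt_one (norm_nonneg _) hp).mul_left _
  have := tprod_one_add_ne_zero_of_summable (f := fun k : ℕ => -(x * p ^ k))
    (fun k => by rw [← sub_eq_add_neg, sub_ne_zero]; exact (h k).symm) hs
  simpa only [infFactorial, sub_eq_add_neg] using this

theorem theta_one {p : ℂ} (hp : ‖p‖ < 1) : theta p 1 = 0 := by
  rw [theta, infFactorial_eq_mul hp 1]
  simp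

theorem theta_inv {p : ℂ} (hp : ‖p‖ < 1) {x : ℂ} (hx : x ≠ 0) :
    theta p x⁻¹ = -x⁻¹ * theta p x := by
  unfold theta
  rw [div_inv_eq_mul, infFactorial_eq_mul hp x, infFactorial_eq_mul hp x⁻¹, div_eq_mul_inv]
  field_simp
  ring

/-- The zeros of `θ(x; p)` are the integral powers of `p`. -/
theorem exists_zpow_of_theta_eq_zero {p : ℂ} (hp0 : p ≠ 0) (hp : ‖p‖ < 1) {x : ℂ} (hx : x ≠ 0)
    (h : theta p x = 0) : ∃ l : ℤ, x = p ^ l := by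
  by_contra! hne
  refine mul_ne_zero (infFactorial_ne_zero hp fun k hk => hne (-k) ?_)
    (infFactorial_ne_zero hp fun k hk => hne (k + 1) ?_) h
  · rw [zpow_neg, zpow_natCast]
    exact eq_inv_of_mul_eq_one_left hk
  · rw [zpow_add₀ hp0, zpow_natCast, zpow_one]
    field_simp at hk
    rw [← hk, mul_comm]

theorem theta_neg_one_ne_zero {p : ℂ} (hp0 : p ≠ 0) (hp : ‖p‖ < 1) : theta p (-1) ≠ 0 := by
  intro h
  obtain ⟨l, hl⟩ := exists_zpow_of_theta_eq_zero hp0 hp (by norm_num) h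
  have h1 : ‖p‖ ^ l = 1 := by rw [← norm_zpow, ← hl]; simp
  have : l = 0 := by
    by_contra h0
    exact h0 ((zpow_eq_one_iff_right₀ (norm_nonneg p) hp.ne).1 h1)
  subst this
  norm_num at hl

/-- The odd entire function `z ↦ exp (-z/2) θ(exp z; p)`. -/
noncomputable def oddTheta (τ : ℍ) (z : ℂ) : ℂ :=
  Complex.exp (-z / 2) * theta (nome τ) (Complex.exp z)

theorem differentiable_oddTheta (τ : ℍ) : Differentiable ℂ (oddTheta τ) := by
  intro z
  have h := (analyticAt_theta (norm_nome_lt_one τ) (Complex.exp_ne_zero z)).differentiableAt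
  have h2 : DifferentiableAt ℂ (fun z => theta (nome τ) (Complex.exp z)) z :=
    h.comp z Complex.differentiable_exp.differentiableAt
  unfold oddTheta
  fun_prop

theorem oddTheta_zero (τ : ℍ) : oddTheta τ 0 = 0 := by
  simp [oddTheta, theta_one (norm_nome_lt_one τ)]

theorem oddTheta_neg (τ : ℍ) (z : ℂ) : oddTheta τ (-z) = -oddTheta τ z := by
  rw [oddTheta, oddTheta, Complex.exp_neg z, theta_inv (norm_nome_lt_one τ) (Complex.exp_ne_zero z),
    ← Complex.exp_neg]
  have : Complex.exp (-z / 2) = Complex.exp (- -z / 2) * Complex.exp (-z) := by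
    rw [← Complex.exp_add]
    ring_nf
  rw [this]
  ring

theorem oddTheta_add_two_pi_I (τ : ℍ) (z : ℂ) :
    oddTheta τ (z + 2 * Real.pi * Complex.I) = -oddTheta τ z := by
  rw [oddTheta, oddTheta, Complex.exp_periodic,
    show -(z + 2 * Real.pi * Complex.I) / 2 = -z / 2 + -(Real.pi * Complex.I) by ring,
    Complex.exp_add, Complex.exp_neg (Real.pi * Complex.I), Complex.exp_pi_mul_I]
  ring

theorem oddTheta_add_nome (τ : ℍ) (z : ℂ) :
    oddTheta τ (z + 2 * Real.pi * Complex.I * τ) =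
      -Complex.exp (-z - Real.pi * Complex.I * τ) * oddTheta τ z := by
  rw [oddTheta, oddTheta, Complex.exp_add, mul_comm (Complex.exp z), ← nome,
    theta_nome_mul (nome_ne_zero τ) (norm_nome_lt_one τ) (Complex.exp_ne_zero z), ← Complex.exp_neg]
  have : Complex.exp (-(z + 2 * Real.pi * Complex.I * τ) / 2) * Complex.exp (-z) =
      Complex.exp (-z - Real.pi * Complex.I * τ) * Complex.exp (-z / 2) := by
    rw [← Complex.exp_add, ← Complex.exp_add]
    ring_nf
  linear_combination (-theta (nome τ) (Complex.exp z)) * this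

/-- The period lattice `2πi ℤ + 2πiτ ℤ` of `z ↦ θ(exp z; p)`. -/
noncomputable def thetaPeriods (τ : ℍ) : PeriodPair where
  ω₁ := 2 * Real.pi * Complex.I
  ω₂ := 2 * Real.pi * Complex.I * τ
  indep := by
    rw [LinearIndependent.pair_iff]
    intro s t h
    have hc : (s : ℂ) + t * τ = 0 := by
      have : (2 * Real.pi * Complex.I) * ((s : ℂ) + t * τ) = 0 := by
        rw [← h]
        simp only [Complex.real_smul]
        ring
      exact (mul_eq_zero.1 this).resolve_left Complex.two_pi_I_ne_zero
    have him := congrArg Complex.im hc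
    have ht : t = 0 := by
      simpa [τ.im_ne_zero] using him
    subst ht
    simpa using hc

theorem mem_lattice_of_oddTheta_eq_zero {τ : ℍ} {z : ℂ} (h : oddTheta τ z = 0) :
    z ∈ (thetaPeriods τ).lattice := by
  have h0 := (mul_eq_zero.1 h).resolve_left (Complex.exp_ne_zero _)
  obtain ⟨l, hl⟩ := exists_zpow_of_theta_eq_zero (nome_ne_zero τ) (norm_nome_lt_one τ)
    (Complex.exp_ne_zero z) h0
  rw [nome, ← Complex.exp_int_mul, Complex.exp_eq_exp_iff_exists_int] at hl
  obtain ⟨m, hm⟩ := hl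
  rw [PeriodPair.mem_lattice]
  refine ⟨m, l, ?_⟩
  rw [hm]
  simp only [thetaPeriods]
  ring

theorem countable_oddTheta_zeros (τ : ℍ) : {z | oddTheta τ z = 0}.Countable := by
  refine (Set.countable_range fun mn : ℤ × ℤ =>
    (mn.1 : ℂ) * (thetaPeriods τ).ω₁ + mn.2 * (thetaPeriods τ).ω₂).mono ?_
  intro z hz
  obtain ⟨m, n, h⟩ := PeriodPair.mem_lattice.1 (mem_lattice_of_oddTheta_eq_zero hz)
  exact ⟨(m, n), h⟩

theorem deriv_oddTheta_zero_ne_zero (τ : ℍ) : deriv (oddTheta τ) 0 ≠ 0 := by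
  set p := nome τ
  have hp := norm_nome_lt_one τ
  set φ : ℂ → ℂ := fun z => Complex.exp (-z / 2) *
    (infFactorial p (p * Complex.exp z) * infFactorial p (p / Complex.exp z)) with hφ
  have hprod : oddTheta τ = fun z => (1 - Complex.exp z) * φ z := by
    funext z
    rw [oddTheta, theta, infFactorial_eq_mul hp]
    ring
  have hd (y : ℂ) : DifferentiableAt ℂ (infFactorial p) y := differentiable_infFactorial hp y
  have hφd : DifferentiableAt ℂ φ 0 := by
    have h1 : DifferentiableAt ℂ (fun z => infFactorial p (p * Complex.exp z)) 0 :=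
      (hd _).comp (0 : ℂ) (by fun_prop)
    have h2 : DifferentiableAt ℂ (fun z => infFactorial p (p / Complex.exp z)) 0 :=
      (hd _).comp (0 : ℂ) (by fun_prop (disch := exact Complex.exp_ne_zero _))
    fun_prop
  have hφ0 : φ 0 ≠ 0 := by
    have hne : infFactorial p p ≠ 0 := by
      refine infFactorial_ne_zero hp fun k hk => ?_
      have : ‖p‖ ^ (k + 1) = 1 := by rw [← norm_pow, pow_succ', hk, norm_one]
      exact (pow_lt_one₀ (norm_nonneg p) hp k.succ_ne_zero).ne this
    simp [hφ, hne]
  have h1 : HasDerivAt (fun z => (1 - Complex.exp z) * φ z)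
      (-Complex.exp 0 * φ 0 + (1 - Complex.exp 0) * deriv φ 0) 0 :=
    ((Complex.hasDerivAt_exp 0).const_sub 1).mul hφd.hasDerivAt
  rw [hprod, h1.deriv]
  simpa using hφ0

/-- Every zero of the odd theta function is simple: near `w` in the period lattice the function
agrees with its translate by `w` up to a nowhere vanishing factor. -/
theorem oddTheta_simple_zero {τ : ℍ} {w : ℂ} (hw : w ∈ (thetaPeriods τ).lattice) :
    oddTheta τ w = 0 ∧ deriv (oddTheta τ) w ≠ 0 := by
  -- multiplication by a nowhere vanishing factor preserves simple zeros
  have key (ω : ℂ) (c : ℂ → ℂ) (hc : Differentiable ℂ c) (hc0 : ∀ z, c z ≠ 0)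
      (h : ∀ z, oddTheta τ (z + ω) = c z * oddTheta τ z) (z : ℂ) :
      (oddTheta τ (z + ω) = 0 ∧ deriv (oddTheta τ) (z + ω) ≠ 0) ↔
        (oddTheta τ z = 0 ∧ deriv (oddTheta τ) z ≠ 0) := by
    have h1 : deriv (oddTheta τ) (z + ω) =
        deriv c z * oddTheta τ z + c z * deriv (oddTheta τ) z := by
      rw [← deriv_comp_add_const, funext h]
      exact deriv_fun_mul (hc z) (differentiable_oddTheta τ z)
    rw [h, h1]
    constructor
    · rintro ⟨h2, h3⟩
      have h4 := (mul_eq_zero.1 h2).resolve_left (hc0 z)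
      rw [h4, mul_zero, zero_add] at h3
      exact ⟨h4, right_ne_zero_of_mul h3⟩
    · rintro ⟨h2, h3⟩
      rw [h2, mul_zero, mul_zero, zero_add]
      exact ⟨rfl, mul_ne_zero (hc0 z) h3⟩
  have k1 := key (thetaPeriods τ).ω₁ (fun _ => -1) (by fun_prop) (by simp)
    (fun z => by rw [neg_one_mul]; exact oddTheta_add_two_pi_I τ z)
  have k2 := key (thetaPeriods τ).ω₂ (fun z => -Complex.exp (-z - Real.pi * Complex.I * τ))
    (by fun_prop) (fun z => neg_ne_zero.2 (Complex.exp_ne_zero _)) (oddTheta_add_nome τ)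
  obtain ⟨m, n, rfl⟩ := PeriodPair.mem_lattice.1 hw
  have p1 : Function.Periodic (fun z => oddTheta τ z = 0 ∧ deriv (oddTheta τ) z ≠ 0)
      (thetaPeriods τ).ω₁ := fun z => propext (k1 z)
  have p2 : Function.Periodic (fun z => oddTheta τ z = 0 ∧ deriv (oddTheta τ) z ≠ 0)
      (thetaPeriods τ).ω₂ := fun z => propext (k2 z)
  have h0 := ((p1.int_mul m).add_period (p2.int_mul n)) 0
  rw [zero_add] at h0
  exact h0.mpr ⟨oddTheta_zero τ, deriv_oddTheta_zero_ne_zero τ⟩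

/-- Division of entire functions: if `g` has only simple zeros and `f` vanishes at all of them,
then `g` divides `f`. -/
theorem exists_differentiable_mul_eq {f g : ℂ → ℂ} (hf : Differentiable ℂ f)
    (hg : Differentiable ℂ g) (h : ∀ z, g z = 0 → f z = 0 ∧ deriv g z ≠ 0) :
    ∃ e : ℂ → ℂ, Differentiable ℂ e ∧ ∀ z, f z = g z * e z := by
  classical
  refine ⟨fun z => if g z = 0 then deriv f z / deriv g z else f z / g z, fun z₀ => ?_, fun z => ?_⟩
  · by_cases hz : g z₀ = 0
    · obtain ⟨hf0, hg0⟩ := h z₀ hz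
      have hdf : DifferentiableAt ℂ (dslope f z₀) z₀ :=
        ((Complex.differentiableOn_dslope Filter.univ_mem).2 hf.differentiableOn).differentiableAt
          Filter.univ_mem
      have hdg : DifferentiableAt ℂ (dslope g z₀) z₀ :=
        ((Complex.differentiableOn_dslope Filter.univ_mem).2 hg.differentiableOn).differentiableAt
          Filter.univ_mem
      have hg1 : dslope g z₀ z₀ ≠ 0 := by rwa [dslope_same]
      refine (hdf.div hdg hg1).congr_of_eventuallyEq ?_
      filter_upwards [hdg.continuousAt.eventually_ne hg1] with z hzne
      by_cases hzz : z = z₀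
      · subst hzz
        simp [hz]
      · have e1 := sub_smul_dslope_of_zero hf0 z
        have e2 := sub_smul_dslope_of_zero hz z
        have hne : z - z₀ ≠ 0 := sub_ne_zero.2 hzz
        rw [smul_eq_mul] at e1 e2
        have : g z ≠ 0 := by rw [← e2]; exact mul_ne_zero hne hzne
        simp only [this, if_false, Pi.div_apply]
        rw [← e1, ← e2, mul_div_mul_left _ _ hne]
    · refine ((hf z₀).div (hg z₀) hz).congr_of_eventuallyEq ?_
      filter_upwards [(hg z₀).continuousAt.eventually_ne hz] with z hzne
      simp [hzne]
  · by_cases hz : g z = 0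
    · simp [hz, (h z hz).1]
    · simp only [hz, if_false]
      field_simp

/-- The product `x ↦ s(x + a) s(x - a)`, where `s` is the odd theta function. Its multipliers with
respect to the period lattice do not depend on `a`. -/
noncomputable def oddThetaPair (τ : ℍ) (a x : ℂ) : ℂ := oddTheta τ (x + a) * oddTheta τ (x - a)

theorem differentiable_oddThetaPair (τ : ℍ) (a : ℂ) : Differentiable ℂ (oddThetaPair τ a) := by
  have h := differentiable_oddTheta τ
  unfold oddThetaPair
  fun_prop

theorem oddThetaPair_add_left_period (τ : ℍ) (a x : ℂ) :
    oddThetaPair τ a (x + (thetaPeriods τ).ω₁) = oddThetaPair τ a x := by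
  have h (y : ℂ) : oddTheta τ (y + (thetaPeriods τ).ω₁) = -oddTheta τ y :=
    oddTheta_add_two_pi_I τ y
  rw [oddThetaPair, add_right_comm, h, add_sub_right_comm, h, neg_mul_neg, oddThetaPair]

theorem oddThetaPair_add_right_period (τ : ℍ) (a x : ℂ) :
    oddThetaPair τ a (x + (thetaPeriods τ).ω₂) =
      Complex.exp (-2 * x - 2 * Real.pi * Complex.I * τ) * oddThetaPair τ a x := by
  have h (y : ℂ) : oddTheta τ (y + (thetaPeriods τ).ω₂) =
      -Complex.exp (-y - Real.pi * Complex.I * τ) * oddTheta τ y := oddTheta_add_nome τ y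
  rw [oddThetaPair, add_right_comm, h, add_sub_right_comm, h, oddThetaPair,
    show -2 * x - 2 * Real.pi * Complex.I * τ =
      (-(x + a) - Real.pi * Complex.I * τ) + (-(x - a) - Real.pi * Complex.I * τ) by ring,
    Complex.exp_add]
  ring

/-- The three-term identity under a genericity assumption on `v`. The left-hand side is, as a
function of `x`, divisible by `s(x + v) s(x - v)`; the quotient is an entire elliptic function,
hence constant, and it vanishes at `x = u`. -/
theorem oddTheta_three_term_generic (τ : ℍ) (y u v : ℂ) (h2 : oddTheta τ (v + v) ≠ 0)
    (huv : oddThetaPair τ v u ≠ 0) (x : ℂ) :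
    oddThetaPair τ y x * oddThetaPair τ v u + oddThetaPair τ u x * oddThetaPair τ y v +
      oddThetaPair τ v x * oddThetaPair τ u y = 0 := by
  set D : ℂ → ℂ := fun x => oddThetaPair τ y x * oddThetaPair τ v u +
    oddThetaPair τ u x * oddThetaPair τ y v + oddThetaPair τ v x * oddThetaPair τ u y with hD
  have hdp (a : ℂ) := differentiable_oddThetaPair τ a
  have hDd : Differentiable ℂ D := by fun_prop
  have hD1 (x : ℂ) : D (x + (thetaPeriods τ).ω₁) = D x := by
    simp only [hD, oddThetaPair_add_left_period]
  have hD2 (x : ℂ) : D (x + (thetaPeriods τ).ω₂) =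
      Complex.exp (-2 * x - 2 * Real.pi * Complex.I * τ) * D x := by
    simp only [hD, oddThetaPair_add_right_period]
    ring
  have hDv : D v = 0 := by
    have : oddTheta τ (u - v) = -oddTheta τ (v - u) := by rw [← oddTheta_neg, neg_sub]
    simp only [hD, oddThetaPair, sub_self, oddTheta_zero, this, add_comm v u]
    ring
  have hDu : D u = 0 := by
    have h1 : oddTheta τ (u - v) = -oddTheta τ (v - u) := by rw [← oddTheta_neg, neg_sub]
    have h2 : oddTheta τ (y - u) = -oddTheta τ (u - y) := by rw [← oddTheta_neg, neg_sub]
    simp only [hD, oddThetaPair, sub_self, oddTheta_zero, h2, add_comm y u]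
    ring
  have hDeven (x : ℂ) : D (-x) = D x := by
    have h (a : ℂ) : oddThetaPair τ a (-x) = oddThetaPair τ a x := by
      rw [oddThetaPair, oddThetaPair, show -x + a = -(x - a) by ring,
        show -x - a = -(x + a) by ring, oddTheta_neg, oddTheta_neg, neg_mul_neg, mul_comm]
    simp only [hD, h]
  have hDlat {w : ℂ} (hw : w ∈ (thetaPeriods τ).lattice) (x : ℂ) (hx : D x = 0) :
      D (x + w) = 0 := by
    have p1 : Function.Periodic (fun z => D z = 0) (thetaPeriods τ).ω₁ := fun z => by
      simp only [hD1]
    have p2 : Function.Periodic (fun z => D z = 0) (thetaPeriods τ).ω₂ := fun z => by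
      simp [hD2, Complex.exp_ne_zero]
    obtain ⟨m, n, rfl⟩ := PeriodPair.mem_lattice.1 hw
    exact (((p1.int_mul m).add_period (p2.int_mul n)) x).mpr hx
  obtain ⟨e, he, hDe⟩ := exists_differentiable_mul_eq hDd (hdp v) (by
    intro z hz
    have hd : deriv (oddThetaPair τ v) z = deriv (oddTheta τ) (z + v) * oddTheta τ (z - v) +
        oddTheta τ (z + v) * deriv (oddTheta τ) (z - v) := by
      have e1 : HasDerivAt (fun z => oddTheta τ (z + v)) (deriv (oddTheta τ) (z + v)) z :=
        (differentiable_oddTheta τ _).hasDerivAt.comp_add_const z v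
      have e2 : HasDerivAt (fun z => oddTheta τ (z - v)) (deriv (oddTheta τ) (z - v)) z :=
        (differentiable_oddTheta τ _).hasDerivAt.comp_sub_const z v
      exact (e1.mul e2).deriv
    have hexcl (ha : oddTheta τ (z + v) = 0) (hb : oddTheta τ (z - v) = 0) : False := by
      have := sub_mem (mem_lattice_of_oddTheta_eq_zero ha) (mem_lattice_of_oddTheta_eq_zero hb)
      rw [add_sub_sub_cancel] at this
      exact h2 (oddTheta_simple_zero this).1
    rcases mul_eq_zero.1 hz with ha | hb
    · have hl := mem_lattice_of_oddTheta_eq_zero ha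
      refine ⟨?_, ?_⟩
      · have := hDlat hl (-v) (by rw [hDeven, hDv])
        rwa [neg_add_cancel_comm_assoc] at this
      · rw [hd, ha, zero_mul, add_zero]
        exact mul_ne_zero (oddTheta_simple_zero hl).2 fun hb => hexcl ha hb
    · have hl := mem_lattice_of_oddTheta_eq_zero hb
      refine ⟨?_, ?_⟩
      · have := hDlat hl v hDv
        rwa [add_sub_cancel] at this
      · rw [hd, hb, mul_zero, zero_add]
        exact mul_ne_zero (fun ha => hexcl ha hb) (oddTheta_simple_zero hl).2)
  have hdense : Dense {z | oddThetaPair τ v z ≠ 0} := by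
    have hc : {z | oddThetaPair τ v z = 0}.Countable := by
      have c1 := (countable_oddTheta_zeros τ).preimage (f := fun z : ℂ => z + v)
        (add_left_injective v)
      have c2 := (countable_oddTheta_zeros τ).preimage (f := fun z : ℂ => z - v)
        (sub_left_injective)
      exact (c1.union c2).mono fun z hz => mul_eq_zero.1 hz
    exact hc.dense_compl ℂ
  have he1 (x : ℂ) : e (x + (thetaPeriods τ).ω₁) = e x := by
    have hcont : Continuous fun x => e (x + (thetaPeriods τ).ω₁) := by
      have := he.continuous
      fun_prop
    refine congrFun (Continuous.ext_on hdense hcont he.continuous fun z hz => ?_) x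
    refine mul_left_cancel₀ hz ?_
    rw [← hDe, ← hD1, hDe, oddThetaPair_add_left_period]
  have he2 (x : ℂ) : e (x + (thetaPeriods τ).ω₂) = e x := by
    have hcont : Continuous fun x => e (x + (thetaPeriods τ).ω₂) := by
      have := he.continuous
      fun_prop
    refine congrFun (Continuous.ext_on hdense hcont he.continuous fun z hz => ?_) x
    refine mul_left_cancel₀ (mul_ne_zero (Complex.exp_ne_zero
      (-2 * z - 2 * Real.pi * Complex.I * τ)) hz) ?_
    rw [mul_assoc _ _ (e z), ← hDe, ← hD2, hDe, oddThetaPair_add_right_period]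
  have hconst (x x' : ℂ) : e x = e x' := by
    refine he.apply_eq_apply_of_bounded (IsZLattice.isCompact_range_of_periodic
      (thetaPeriods τ).lattice e he.continuous fun z w hw => ?_).isBounded x x'
    have p1 : Function.Periodic e (thetaPeriods τ).ω₁ := he1
    have p2 : Function.Periodic e (thetaPeriods τ).ω₂ := he2
    obtain ⟨m, n, rfl⟩ := PeriodPair.mem_lattice.1 hw
    exact ((p1.int_mul m).add_period (p2.int_mul n)) z
  have heu : e u = 0 := by
    have := hDe u
    rw [hDu] at this
    exact (mul_eq_zero.1 this.symm).resolve_left huv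
  change D x = 0
  rw [hDe, hconst x u, heu, mul_zero]

/-- The three-term identity (Weierstrass' addition formula) for the odd theta function. -/
theorem oddTheta_three_term (τ : ℍ) (x y u v : ℂ) :
    oddThetaPair τ y x * oddThetaPair τ v u + oddThetaPair τ u x * oddThetaPair τ y v +
      oddThetaPair τ v x * oddThetaPair τ u y = 0 := by
  have hc := countable_oddTheta_zeros τ
  have c1 := hc.preimage (f := fun v : ℂ => v + v) (fun a b (h : a + a = b + b) => by
    linear_combination h / 2)
  have c2 := hc.preimage (f := fun v : ℂ => u + v) (add_right_injective u)
  have c3 := hc.preimage (f := fun v : ℂ => u - v) sub_right_injective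
  have hdense := ((c1.union c2).union c3).dense_compl ℂ
  have hs := (differentiable_oddTheta τ).continuous
  refine congrFun (Continuous.ext_on hdense (f := fun v => oddThetaPair τ y x * oddThetaPair τ v u +
    oddThetaPair τ u x * oddThetaPair τ y v + oddThetaPair τ v x * oddThetaPair τ u y)
    (g := fun _ => 0) (by unfold oddThetaPair; fun_prop) continuous_const fun v hv => ?_) v
  simp only [Set.mem_compl_iff, Set.mem_union, Set.mem_preimage, Set.mem_ofPred_eq, not_or] at hv
  exact oddTheta_three_term_generic τ y u v hv.1.1 (mul_ne_zero hv.1.2 hv.2) x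

/-- The three-term identity for the multiplicative theta function, with four independent
variables. -/
theorem theta_three_term (τ : ℍ) {X Y B S : ℂ} (hX : X ≠ 0) (hY : Y ≠ 0) (hB : B ≠ 0)
    (hS : S ≠ 0) :
    theta (nome τ) (X * S / Y) * theta (nome τ) (X * B) * theta (nome τ) (S * B) *
        theta (nome τ) Y =
      theta (nome τ) (Y * B) * theta (nome τ) S * theta (nome τ) (X * S * B / Y) *
        theta (nome τ) X -
      Y * (theta (nome τ) (S / Y) * theta (nome τ) B * theta (nome τ) (X * S * B) *
        theta (nome τ) (X / Y)) := by
  obtain ⟨x, rfl⟩ : ∃ x, Complex.exp x = X := ⟨_, Complex.exp_log hX⟩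
  obtain ⟨y, rfl⟩ : ∃ x, Complex.exp x = Y := ⟨_, Complex.exp_log hY⟩
  obtain ⟨b, rfl⟩ : ∃ x, Complex.exp x = B := ⟨_, Complex.exp_log hB⟩
  obtain ⟨s, rfl⟩ : ∃ x, Complex.exp x = S := ⟨_, Complex.exp_log hS⟩
  have hθ (z : ℂ) : theta (nome τ) (Complex.exp z) = Complex.exp (z / 2) * oddTheta τ z := by
    rw [oddTheta, ← mul_assoc, ← Complex.exp_add, neg_div, add_neg_cancel, Complex.exp_zero,
      one_mul]
  simp only [← Complex.exp_add, ← Complex.exp_sub, hθ]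
  -- half sums of the arguments turn the products into the pairs of the additive identity
  have h := oddTheta_three_term τ (x + (s - y + b) / 2) ((s - y + b) / 2) ((s - y - b) / 2)
    ((s + y + b) / 2)
  have a1 : x + (s - y + b) / 2 + (s - y + b) / 2 = x + s + b - y := by ring
  have a2 : x + (s - y + b) / 2 - (s - y + b) / 2 = x := by ring
  have a3 : (s - y - b) / 2 + (s + y + b) / 2 = s := by ring
  have a4 : (s - y - b) / 2 - (s + y + b) / 2 = -(y + b) := by ring
  have a5 : x + (s - y + b) / 2 + (s - y - b) / 2 = x + s - y := by ring
  have a6 : x + (s - y + b) / 2 - (s - y - b) / 2 = x + b := by ring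
  have a7 : (s + y + b) / 2 + (s - y + b) / 2 = s + b := by ring
  have a8 : (s + y + b) / 2 - (s - y + b) / 2 = y := by ring
  have a9 : x + (s - y + b) / 2 + (s + y + b) / 2 = x + s + b := by ring
  have a10 : x + (s - y + b) / 2 - (s + y + b) / 2 = x - y := by ring
  have a11 : (s - y + b) / 2 + (s - y - b) / 2 = s - y := by ring
  have a12 : (s - y + b) / 2 - (s - y - b) / 2 = b := by ring
  simp only [oddThetaPair, a1, a2, a3, a4, a5, a6, a7, a8, a9, a10, a11, a12, oddTheta_neg] at h
  have hE (z₁ z₂ z₃ z₄ : ℂ) (hz : z₁ + z₂ + z₃ + z₄ = 2 * (x + s + b)) :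
      Complex.exp (z₁ / 2) * Complex.exp (z₂ / 2) * Complex.exp (z₃ / 2) * Complex.exp (z₄ / 2) =
        Complex.exp (x + s + b) := by
    rw [← Complex.exp_add, ← Complex.exp_add, ← Complex.exp_add]
    congr 1
    linear_combination hz / 2
  have e1 := hE (x + s - y) (x + b) (s + b) y (by ring)
  have e2 := hE (y + b) s (x + s + b - y) x (by ring)
  have e3 : Complex.exp y * (Complex.exp ((s - y) / 2) * Complex.exp (b / 2) *
      Complex.exp ((x + s + b) / 2) * Complex.exp ((x - y) / 2)) = Complex.exp (x + s + b) := by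
    rw [← Complex.exp_add, ← Complex.exp_add, ← Complex.exp_add, ← Complex.exp_add]
    congr 1
    ring
  linear_combination Complex.exp (x + s + b) * h +
    oddTheta τ (x + s - y) * oddTheta τ (x + b) * oddTheta τ (s + b) * oddTheta τ y * e1 -
    oddTheta τ (y + b) * oddTheta τ s * oddTheta τ (x + s + b - y) * oddTheta τ x * e2 +
    oddTheta τ (s - y) * oddTheta τ b * oddTheta τ (x + s + b) * oddTheta τ (x - y) * e3

/-! ### Theta functions in the field of meromorphic functions -/

section Theta

variable {r : ℕ}

theorem th_one (τ : ℍ) : th τ (1 : (Hol r)ˣ) = 0 := by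
  have : thetaHol τ (1 : (Hol r)ˣ) = 0 :=
    Subtype.ext (funext fun _ => theta_one (norm_nome_lt_one τ))
  rw [th, this, map_zero]

theorem th_inv (τ : ℍ) (x : (Hol r)ˣ) :
    th τ x⁻¹ = -((toMer x : (Mer r)ˣ) : Mer r)⁻¹ * th τ x := by
  have h : (x : Hol r) * thetaHol τ x⁻¹ = -thetaHol τ x := by
    refine Subtype.ext (funext fun u => ?_)
    have hx := unit_apply_ne_zero x u
    have hinv : (x⁻¹).1.1 u = (x.1.1 u)⁻¹ :=
      eq_inv_of_mul_eq_one_right (congrFun (congrArg Subtype.val x.mul_inv) u)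
    change x.1.1 u * theta (nome τ) ((x⁻¹).1.1 u) = -theta (nome τ) (x.1.1 u)
    rw [hinv, theta_inv (norm_nome_lt_one τ) hx]
    field_simp
  have h' : ((toMer x : (Mer r)ˣ) : Mer r) * th τ x⁻¹ = -th τ x := by
    have h' := congrArg (algebraMap (Hol r) (Mer r)) h
    rwa [map_mul, map_neg] at h'
  have hx := (toMer x).ne_zero
  field_simp
  linear_combination h'

theorem unit_div_apply (x y : (Hol r)ˣ) (u : Fin r → ℂ) :
    (x / y).1.1 u = x.1.1 u / y.1.1 u := by
  have h : (x / y).1.1 u * y.1.1 u = x.1.1 u :=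
    congrFun (congrArg Subtype.val (congrArg Units.val (div_mul_cancel x y))) u
  rw [eq_div_iff (unit_apply_ne_zero y u), h]

/-- The three-term identity in the field of meromorphic functions. -/
theorem th_three_term (τ : ℍ) (x y b s : (Hol r)ˣ) :
    th τ (x * s / y) * th τ (x * b) * th τ (s * b) * th τ y =
      th τ (y * b) * th τ s * th τ (x * s * b / y) * th τ x -
      toMer y * (th τ (s / y) * th τ b * th τ (x * s * b) * th τ (x / y)) := by
  have h : thetaHol τ (x * s / y) * thetaHol τ (x * b) * thetaHol τ (s * b) * thetaHol τ y =
      thetaHol τ (y * b) * thetaHol τ s * thetaHol τ (x * s * b / y) * thetaHol τ x -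
      y * (thetaHol τ (s / y) * thetaHol τ b * thetaHol τ (x * s * b) * thetaHol τ (x / y)) := by
    refine Subtype.ext (funext fun u => ?_)
    have := theta_three_term τ (unit_apply_ne_zero x u) (unit_apply_ne_zero y u)
      (unit_apply_ne_zero b u) (unit_apply_ne_zero s u)
    change theta (nome τ) ((x * s / y).1.1 u) * theta (nome τ) (x.1.1 u * b.1.1 u) *
        theta (nome τ) (s.1.1 u * b.1.1 u) * theta (nome τ) (y.1.1 u) =
      theta (nome τ) (y.1.1 u * b.1.1 u) * theta (nome τ) (s.1.1 u) *
        theta (nome τ) ((x * s * b / y).1.1 u) * theta (nome τ) (x.1.1 u) -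
      y.1.1 u * (theta (nome τ) ((s / y).1.1 u) * theta (nome τ) (b.1.1 u) *
        theta (nome τ) (x.1.1 u * s.1.1 u * b.1.1 u) * theta (nome τ) ((x / y).1.1 u))
    rw [unit_div_apply, unit_div_apply, unit_div_apply, unit_div_apply]
    exact this
  have h' := congrArg (algebraMap (Hol r) (Mer r)) h
  simp only [map_mul, map_sub] at h'
  exact h'

theorem th_ne_zero_of_apply (τ : ℍ) {x : (Hol r)ˣ} {u : Fin r → ℂ}
    (h : theta (nome τ) (x.1.1 u) ≠ 0) : th τ x ≠ 0 := by
  intro h0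
  have h1 : thetaHol τ x = 0 :=
    IsFractionRing.injective (Hol r) (Mer r) (by rw [map_zero]; exact h0)
  exact h (congrFun (congrArg Subtype.val h1) u)

theorem qC_pow_apply (σ : ℂ) (m : ℕ) (u : Fin r → ℂ) : (qC r σ ^ m).1.1 u = base σ ^ m := by
  induction m with
  | zero => rfl
  | succ m ih =>
    rw [pow_succ, pow_succ, ← ih]
    rfl

theorem th_qC_pow_ne_zero {σ : ℂ} (τ : ℍ) {m : ℕ} (h : ∀ l : ℤ, base σ ^ m ≠ nome τ ^ l) :
    th τ (qC r σ ^ m) ≠ 0 := by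
  refine th_ne_zero_of_apply τ (u := 0) fun h0 => ?_
  rw [qC_pow_apply] at h0
  obtain ⟨l, hl⟩ := exists_zpow_of_theta_eq_zero (nome_ne_zero τ) (norm_nome_lt_one τ)
    (pow_ne_zero _ (base_ne_zero σ)) h0
  exact h l hl

/-- A nowhere vanishing entire function which takes every nonzero value is not a zero of the
theta function. -/
theorem th_ne_zero_of_surjective (τ : ℍ) {x : (Hol r)ˣ} (h : ∀ c : ℂ, c ≠ 0 → ∃ u, x.1.1 u = c) :
    th τ x ≠ 0 := by
  obtain ⟨u, hu⟩ := h (-1) (by norm_num)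
  refine th_ne_zero_of_apply τ (u := u) ?_
  rw [hu]
  exact theta_neg_one_ne_zero (nome_ne_zero τ) (norm_nome_lt_one τ)

theorem const_apply (c : ℂˣ) (u : Fin r → ℂ) : (const (r := r) c).1.1 u = c := rfl

theorem qC_zpow (σ : ℂ) (m : ℤ) :
    qC r σ ^ m = const (Units.mk0 (base σ) (base_ne_zero σ) ^ m) := by
  rw [qC, const, const, map_zpow]

theorem exists_var_apply_eq {σ : ℂ} (hσ : σ ≠ 0) (i : Fin r) {c : ℂ} (hc : c ≠ 0) :
    ∃ u : Fin r → ℂ, (var σ i).1.1 u = c ∧ ∀ j, j ≠ i → (var σ j).1.1 u = 1 := by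
  refine ⟨Pi.single i (Complex.log c / (2 * Real.pi * Complex.I * σ)), ?_, fun j hj => ?_⟩
  · change Complex.exp (2 * Real.pi * Complex.I * σ * _) = c
    rw [Pi.single_eq_same, mul_div_cancel₀ _ (mul_ne_zero Complex.two_pi_I_ne_zero hσ),
      Complex.exp_log hc]
  · change Complex.exp (2 * Real.pi * Complex.I * σ * _) = 1
    rw [Pi.single_eq_of_ne hj, mul_zero, Complex.exp_zero]

theorem th_var_mul_ne_zero {σ : ℂ} (hσ : σ ≠ 0) (τ : ℍ) (i : Fin r) (m : ℤ) :
    th τ (var σ i * qC r σ ^ m) ≠ 0 := by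
  refine th_ne_zero_of_surjective τ fun c hc => ?_
  rw [qC_zpow]
  set d := Units.mk0 (base σ) (base_ne_zero σ) ^ m
  obtain ⟨u, hu, -⟩ := exists_var_apply_eq hσ i (div_ne_zero hc d.ne_zero)
  refine ⟨u, ?_⟩
  change (var σ i).1.1 u * (const d).1.1 u = c
  rw [hu, const_apply, div_mul_cancel₀ _ d.ne_zero]

theorem th_var_div_ne_zero {σ : ℂ} (hσ : σ ≠ 0) (τ : ℍ) {i j : Fin r} (hij : i ≠ j) (m : ℤ) :
    th τ (var σ i * qC r σ ^ m / var σ j) ≠ 0 := by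
  refine th_ne_zero_of_surjective τ fun c hc => ?_
  rw [qC_zpow]
  set d := Units.mk0 (base σ) (base_ne_zero σ) ^ m
  obtain ⟨u, hu, hj⟩ := exists_var_apply_eq hσ i (div_ne_zero hc d.ne_zero)
  refine ⟨u, ?_⟩
  rw [unit_div_apply, hj j hij.symm, div_one]
  change (var σ i).1.1 u * (const d).1.1 u = c
  rw [hu, const_apply, div_mul_cancel₀ _ d.ne_zero]

/-! ### The elliptic partial fraction expansion -/

/-- One summand of the partial fraction expansion, multiplied by a further quotient of theta
functions, splits into two summands. -/
theorem th_div_mul_th_div (τ : ℍ) (x s a b c : (Hol r)ˣ) (hs : th τ s ≠ 0)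
    (hsb : th τ (s * b) ≠ 0) (hxa : th τ (x / a) ≠ 0) (hxc : th τ (x / c) ≠ 0)
    (hac : th τ (a / c) ≠ 0) :
    th τ (x * b / c) / th τ (x / c) * (th τ (x * s / a) / (th τ s * th τ (x / a))) =
      th τ (x * (s * b) / a) / (th τ (s * b) * th τ (x / a)) * (th τ (a * b / c) / th τ (a / c)) +
      th τ (x * (s * b) / c) / (th τ (s * b) * th τ (x / c)) * th τ b *
        (th τ (c * s / a) / (th τ s * th τ (c / a))) := by
  have h := th_three_term τ (x / c) (a / c) b s
  have hinv : th τ (c / a) = -((toMer (a / c) : (Mer r)ˣ) : Mer r)⁻¹ * th τ (a / c) := by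
    rw [← th_inv, inv_div]
  have h0 := (toMer (a / c)).ne_zero
  have g1 : x / c * s / (a / c) = x * s / a :=
    Additive.ofMul.injective (by simp only [ofMul_mul, ofMul_div]; abel)
  have g2 : x / c * b = x * b / c := by rw [div_mul_eq_mul_div]
  have g3 : a / c * b = a * b / c := by rw [div_mul_eq_mul_div]
  have g4 : x / c * s * b / (a / c) = x * (s * b) / a :=
    Additive.ofMul.injective (by simp only [ofMul_mul, ofMul_div]; abel)
  have g5 : s / (a / c) = c * s / a := by rw [div_div_eq_mul_div, mul_comm]
  have g6 : x / c * s * b = x * (s * b) / c := by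
    rw [mul_assoc, div_mul_eq_mul_div]
  have g7 : x / c / (a / c) = x / a := div_div_div_cancel_right x a c
  rw [g1, g2, g3, g4, g5, g6, g7] at h
  rw [hinv]
  field_simp
  linear_combination h

/-- The elliptic partial fraction expansion, by induction on the set of poles. The contributions of
the summands to the new pole `a c` add up, by the expansion over the old poles at the point `a c`. -/
theorem prod_th_div_eq_sum {ι : Type*} [DecidableEq ι] (τ : ℍ) (a z : ι → (Hol r)ˣ)
    (s : Finset ι) (hs : s.Nonempty)
    (ha : ∀ i ∈ s, ∀ j ∈ s, i ≠ j → th τ (a i / a j) ≠ 0)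
    (hz : ∀ t ⊆ s, t.Nonempty → th τ (∏ i ∈ t, z i) ≠ 0) (x : (Hol r)ˣ)
    (hx : ∀ i ∈ s, th τ (x / a i) ≠ 0) :
    ∏ j ∈ s, th τ (x * z j / a j) / th τ (x / a j) =
      ∑ i ∈ s, th τ (x * (∏ j ∈ s, z j) / a i) / (th τ (∏ j ∈ s, z j) * th τ (x / a i)) *
        th τ (z i) * ∏ j ∈ s.erase i, th τ (a i * z j / a j) / th τ (a i / a j) := by
  induction hs using Finset.Nonempty.cons_induction generalizing x with
  | singleton i =>
    have h1 := hz {i} subset_rfl (Finset.singleton_nonempty i)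
    have h2 := hx i (Finset.mem_singleton_self i)
    simp only [Finset.prod_singleton, Finset.sum_singleton, Finset.erase_singleton,
      Finset.prod_empty] at h1 ⊢
    field_simp
  | cons c s hc hs ih =>
    have hne {i : ι} (hi : i ∈ s) : i ≠ c := fun h => hc (h ▸ hi)
    have hmem {i : ι} (hi : i ∈ s) : i ∈ Finset.cons c s hc := Finset.mem_cons_of_mem hi
    have hcm := Finset.mem_cons_self c s (h := hc)
    have ih' := ih (fun i hi j hj => ha i (hmem hi) j (hmem hj))
      (fun t ht => hz t (ht.trans (Finset.subset_cons hc)))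
    have ihx := ih' x fun i hi => hx i (hmem hi)
    have ihc := ih' (a c) fun i hi => ha c hcm i (hmem hi) (hne hi).symm
    have hS := hz s (Finset.subset_cons hc) hs
    have hSc := hz _ subset_rfl ⟨c, hcm⟩
    rw [Finset.prod_cons, mul_comm] at hSc
    have he {i : ι} (hi : i ∈ s) : (Finset.cons c s hc).erase i =
        Finset.cons c (s.erase i) (fun h => hc (Finset.mem_of_mem_erase h)) := by
      rw [Finset.erase_cons_of_ne hc (hne hi).symm]
    rw [Finset.prod_cons, Finset.sum_cons, Finset.prod_cons, ihx, Finset.erase_cons, ihc,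
      mul_comm (z c), Finset.mul_sum, Finset.mul_sum, ← Finset.sum_add_distrib]
    refine Finset.sum_congr rfl fun i hi => ?_
    rw [he hi, Finset.prod_cons]
    have h := th_div_mul_th_div τ x (∏ j ∈ s, z j) (a i) (z c) (a c) hS hSc (hx i (hmem hi))
      (hx c hcm) (ha i (hmem hi) c hcm (hne hi))
    linear_combination (th τ (z i) *
      ∏ j ∈ s.erase i, th τ (a i * z j / a j) / th τ (a i / a j)) * h

/-- The partial fraction expansion at the point `(∏ z j)⁻¹`, normalized to a partition of unity. -/
theorem sum_th_div_eq_one {ι : Type*} [DecidableEq ι] (τ : ℍ) (a z : ι → (Hol r)ˣ)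
    (s : Finset ι) (hs : s.Nonempty)
    (ha : ∀ i ∈ s, ∀ j ∈ s, i ≠ j → th τ (a i / a j) ≠ 0)
    (hz : ∀ t ⊆ s, t.Nonempty → th τ (∏ i ∈ t, z i) ≠ 0)
    (hx : ∀ i ∈ s, th τ (a i * ∏ j ∈ s, z j) ≠ 0)
    (hx' : ∀ i ∈ s, th τ (a i * (∏ j ∈ s, z j) / z i) ≠ 0) :
    ∑ i ∈ s, th τ (a i) * th τ (z i) / (th τ (∏ j ∈ s, z j) * th τ (a i * ∏ j ∈ s, z j)) *
      (∏ j ∈ s.erase i, th τ (a i * z j / a j) / th τ (a i / a j)) *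
      (∏ j ∈ s, th τ (a j * ∏ l ∈ s, z l) / th τ (a j * (∏ l ∈ s, z l) / z j)) = 1 := by
  set Z := ∏ j ∈ s, z j with hZ
  have hZ0 := (toMer Z).ne_zero
  have h1 (i : ι) : Z⁻¹ / a i = (a i * Z)⁻¹ := by rw [mul_inv_rev, div_eq_mul_inv]
  have h := prod_th_div_eq_sum τ a z s hs ha hz Z⁻¹ (fun i hi => by
    rw [h1, th_inv]
    exact mul_ne_zero (neg_ne_zero.2 (inv_ne_zero (toMer _).ne_zero)) (hx i hi))
  have hl (j : ι) : th τ (Z⁻¹ * z j / a j) / th τ (Z⁻¹ / a j) =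
      toMer (z j) * (th τ (a j * Z / z j) / th τ (a j * Z)) := by
    have e1 := (toMer (a j)).ne_zero
    have e2 := (toMer (z j)).ne_zero
    rw [h1, show Z⁻¹ * z j / a j = (a j * Z / z j)⁻¹ from
      Additive.ofMul.injective (by simp only [ofMul_mul, ofMul_div, ofMul_inv]; abel), th_inv, th_inv]
    simp only [map_mul, map_div, Units.val_mul, Units.val_div_eq_div_val]
    field_simp
  have hr (i : ι) : th τ (Z⁻¹ * Z / a i) / (th τ Z * th τ (Z⁻¹ / a i)) =
      toMer Z * (th τ (a i) / (th τ Z * th τ (a i * Z))) := by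
    have e1 := (toMer (a i)).ne_zero
    rw [h1, inv_mul_cancel, one_div, th_inv, th_inv]
    simp only [map_mul, Units.val_mul]
    field_simp
  have hprod : ∏ j ∈ s, ((toMer (z j) : (Mer r)ˣ) : Mer r) = toMer Z := by
    rw [hZ, map_prod, Units.coe_prod]
  rw [← hZ] at h
  simp only [hl, hr, Finset.prod_mul_distrib, hprod] at h
  have h3 : ∏ j ∈ s, th τ (a j * Z / z j) / th τ (a j * Z) =
      ∑ i ∈ s, th τ (a i) * th τ (z i) / (th τ Z * th τ (a i * Z)) *
      ∏ j ∈ s.erase i, th τ (a i * z j / a j) / th τ (a i / a j) := by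
    refine mul_left_cancel₀ hZ0 ?_
    rw [h, Finset.mul_sum]
    refine Finset.sum_congr rfl fun i _ => ?_
    ring
  rw [← Finset.sum_mul, ← h3, ← Finset.prod_mul_distrib]
  refine Finset.prod_eq_one fun j hj => ?_
  have e1 := hx j hj
  have e2 := hx' j hj
  field_simp

end Theta

/-! ### Existence of normal forms -/

section NormalForm

variable {r : ℕ} {σ : ℂ} (hσ : σ ≠ 0) (τ : ℍ)

theorem X_mul_C (i : Fin r) (f : TotallyElliptic r σ τ) :
    X hσ τ i * C hσ τ f = C hσ τ (shift i f) * X hσ τ i := by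
  have h := RingQuot.mkAlgHom_rel ℂ (Rel.shift (hσ := hσ) (τ := τ) i f)
  rwa [map_mul, map_mul] at h

theorem X_mul_X {i j : Fin r} (hij : i < j) :
    X hσ τ j * X hσ τ i = C hσ τ (weight hσ τ i j 1 1) * X hσ τ i * X hσ τ j := by
  have h := RingQuot.mkAlgHom_rel ℂ (Rel.comm (hσ := hσ) (τ := τ) i j hij)
  rwa [map_mul, map_mul, map_mul] at h

theorem exists_X_pow_mul_C (i : Fin r) (m : ℕ) (f : TotallyElliptic r σ τ) :
    ∃ g, X hσ τ i ^ m * C hσ τ f = C hσ τ g * X hσ τ i ^ m := by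
  induction m generalizing f with
  | zero => exact ⟨f, by simp⟩
  | succ m ih =>
    obtain ⟨g, hg⟩ := ih (shift i f)
    exact ⟨g, by rw [pow_succ, mul_assoc, X_mul_C, ← mul_assoc, hg, mul_assoc]⟩

theorem exists_X_mul_X_pow {i l : Fin r} (hl : l < i) (m : ℕ) :
    ∃ g, X hσ τ i * X hσ τ l ^ m = C hσ τ g * X hσ τ l ^ m * X hσ τ i := by
  induction m with
  | zero => exact ⟨1, by simp⟩
  | succ m ih =>
    obtain ⟨g, hg⟩ := ih
    obtain ⟨g', hg'⟩ := exists_X_pow_mul_C hσ τ l m (weight hσ τ l i 1 1)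
    refine ⟨g * g', ?_⟩
    rw [pow_succ, ← mul_assoc, hg, mul_assoc, X_mul_X hσ τ hl, ← mul_assoc, ← mul_assoc,
      mul_assoc (C hσ τ g), hg', map_mul]
    simp only [mul_assoc]

/-- The list version of `exists_X_mul_monomial`, which allows induction on the set of variables. -/
theorem exists_X_mul_list_prod (i : Fin r) (k : Fin r → ℕ) (L : List (Fin r))
    (hL : L.Pairwise (· < ·)) (hi : i ∈ L) :
    ∃ c, X hσ τ i * (L.map fun l => X hσ τ l ^ k l).prod =
        C hσ τ c * (L.map fun l => X hσ τ l ^ (k + Pi.single i 1 : Fin r → ℕ) l).prod ∧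
      ((∀ l < i, k l = 0) → c = 1) := by
  induction L with
  | nil => simp at hi
  | cons l L ih =>
    rw [List.pairwise_cons] at hL
    simp only [List.map_cons, List.prod_cons]
    by_cases hil : i = l
    · subst hil
      refine ⟨1, ?_, fun _ => rfl⟩
      rw [map_one, one_mul, ← mul_assoc, ← pow_succ']
      congr 1
      · simp
      · congr 1
        refine List.map_congr_left fun j hj => ?_
        rw [Pi.add_apply, Pi.single_eq_of_ne (hL.1 j hj).ne', add_zero]
    · have hiL : i ∈ L := (List.mem_cons.1 hi).resolve_left hil
      have hli := hL.1 i hiL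
      obtain ⟨c, hc, hc1⟩ := ih hL.2 hiL
      have hkl : (k + Pi.single i 1 : Fin r → ℕ) l = k l := by
        rw [Pi.add_apply, Pi.single_eq_of_ne hli.ne, add_zero]
      rw [hkl]
      by_cases h0 : ∀ l < i, k l = 0
      · refine ⟨1, ?_, fun _ => rfl⟩
        rw [h0 l hli, pow_zero, one_mul, one_mul, hc, hc1 h0]
      · obtain ⟨g, hg⟩ := exists_X_mul_X_pow hσ τ hli (k l)
        obtain ⟨c', hc'⟩ := exists_X_pow_mul_C hσ τ l (k l) c
        refine ⟨g * c', ?_, fun h => absurd h h0⟩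
        rw [← mul_assoc, hg, mul_assoc, hc, ← mul_assoc, mul_assoc (C hσ τ g), hc', map_mul]
        simp only [mul_assoc]

/-- Multiplying an ordered monomial by a variable gives a multiple of an ordered monomial; no
reordering takes place if only variables with larger indices occur. -/
theorem exists_X_mul_monomial (i : Fin r) (k : Fin r → ℕ) :
    ∃ c, X hσ τ i * monomial hσ τ k = C hσ τ c * monomial hσ τ (k + Pi.single i 1) ∧
      ((∀ l < i, k l = 0) → c = 1) := by
  simpa only [monomial, List.ofFn_eq_map] using exists_X_mul_list_prod hσ τ i k (List.finRange r)
    (List.pairwise_lt_finRange r) (List.mem_finRange i)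

theorem monomial_zero : monomial hσ τ (0 : Fin r → ℕ) = 1 := by
  simp [monomial, List.ofFn_eq_map]

theorem X_mul_monomial_of_lt {i : Fin r} {k : Fin r → ℕ} (h : ∀ l < i, k l = 0) :
    X hσ τ i * monomial hσ τ k = monomial hσ τ (k + Pi.single i 1) := by
  obtain ⟨c, hc, h1⟩ := exists_X_mul_monomial hσ τ i k
  rw [hc, h1 h, map_one, one_mul]

/-- The span of the terms `f X^k` is stable under left multiplication by the generators. -/
theorem exists_normal_form (x : EllAlgebra r hσ τ) :
    ∃ f : (Fin r → ℕ) →₀ TotallyElliptic r σ τ,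
      x = f.sum fun k g => C hσ τ g * monomial hσ τ k := by
  set N : AddSubmonoid (EllAlgebra r hσ τ) := AddSubmonoid.closure
    (Set.range fun gk : TotallyElliptic r σ τ × (Fin r → ℕ) =>
      C hσ τ gk.1 * monomial hσ τ gk.2) with hN
  have hmem (g : TotallyElliptic r σ τ) (k : Fin r → ℕ) : C hσ τ g * monomial hσ τ k ∈ N :=
    AddSubmonoid.subset_closure ⟨(g, k), rfl⟩
  have hcl (y : EllAlgebra r hσ τ) (h : ∀ g k, y * (C hσ τ g * monomial hσ τ k) ∈ N) :
      ∀ x ∈ N, y * x ∈ N := by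
    intro x hx
    induction hx using AddSubmonoid.closure_induction with
    | mem x hx =>
      obtain ⟨⟨g, k⟩, rfl⟩ := hx
      exact h g k
    | zero => simp
    | add x y _ _ hx hy => rw [mul_add]; exact add_mem hx hy
  have hC (f : TotallyElliptic r σ τ) : ∀ x ∈ N, C hσ τ f * x ∈ N := hcl _ fun g k => by
    rw [← mul_assoc, ← map_mul]
    exact hmem _ _
  have hX (i : Fin r) : ∀ x ∈ N, X hσ τ i * x ∈ N := hcl _ fun g k => by
    obtain ⟨c, hc, -⟩ := exists_X_mul_monomial hσ τ i k
    rw [← mul_assoc, X_mul_C, mul_assoc, hc, ← mul_assoc, ← map_mul]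
    exact hmem _ _
  have hall (a : Free r σ τ) : ∀ x ∈ N, RingQuot.mkAlgHom ℂ (Rel hσ τ) a * x ∈ N := by
    induction a using FreeAlgebra.induction with
    | grade0 c =>
      intro x hx
      rw [AlgHom.commutes, ← (C hσ τ).commutes]
      exact hC _ x hx
    | grade1 s =>
      rcases s with i | f
      · exact hX i
      · exact hC f
    | mul a b ha hb =>
      intro x hx
      rw [map_mul, mul_assoc]
      exact ha _ (hb x hx)
    | add a b ha hb =>
      intro x hx
      rw [map_add, add_mul]
      exact add_mem (ha x hx) (hb x hx)
  have hx : x ∈ N := by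
    obtain ⟨a, rfl⟩ := RingQuot.mkAlgHom_surjective ℂ (Rel hσ τ) x
    have h1 : (1 : EllAlgebra r hσ τ) ∈ N := by
      have := hmem 1 0
      rwa [map_one, one_mul, monomial_zero] at this
    have := hall a 1 h1
    rwa [mul_one] at this
  induction hx using AddSubmonoid.closure_induction with
  | mem x hx =>
    obtain ⟨⟨g, k⟩, rfl⟩ := hx
    exact ⟨Finsupp.single k g, by rw [Finsupp.sum_single_index]; simp⟩
  | zero => exact ⟨0, by simp⟩
  | add x y _ _ hx hy =>
    obtain ⟨f, rfl⟩ := hx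
    obtain ⟨g, rfl⟩ := hy
    refine ⟨f + g, ?_⟩
    rw [Finsupp.sum_add_index'] <;> simp [add_mul]

end NormalForm

/-! ### Theta functions under the translations of the variables -/

section Operators

variable {r : ℕ}

/-- `θ(a_i q ^ m)`. -/
noncomputable def thVar (σ : ℂ) (τ : ℍ) (i : Fin r) (m : ℤ) : Mer r :=
  th τ (var σ i * qC r σ ^ m)

/-- `θ(a_i q ^ m / a_j)`. -/
noncomputable def thRatio (σ : ℂ) (τ : ℍ) (i j : Fin r) (m : ℤ) : Mer r :=
  th τ (var σ i * qC r σ ^ m / var σ j)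

/-- The automorphism `f(a_1, …, a_r) ↦ f(a_1 q², …, a_i q, …, a_r q²)` of the field of all
meromorphic functions. -/
noncomputable def shiftMer (i : Fin r) : Mer r ≃ₐ[ℂ] Mer r :=
  translate fun j => if j = i then 1 else 2

theorem thVar_ne_zero {σ : ℂ} (hσ : σ ≠ 0) (τ : ℍ) (i : Fin r) (m : ℤ) : thVar σ τ i m ≠ 0 :=
  th_var_mul_ne_zero hσ τ i m

theorem thRatio_ne_zero {σ : ℂ} (hσ : σ ≠ 0) (τ : ℍ) {i j : Fin r} (hij : i ≠ j) (m : ℤ) :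
    thRatio σ τ i j m ≠ 0 :=
  th_var_div_ne_zero hσ τ hij m

theorem translateUnit_var_intCast (σ : ℂ) (i : Fin r) (e : Fin r → ℤ) :
    translateUnit (fun j => (e j : ℂ)) (var σ i) = var σ i * qC r σ ^ e i := by
  rw [qC_zpow]
  refine Units.ext (Subtype.ext (funext fun u => ?_))
  change Complex.exp (2 * Real.pi * Complex.I * σ * (u i + e i)) =
    Complex.exp (2 * Real.pi * Complex.I * σ * u i) *
      ((Units.mk0 (base σ) (base_ne_zero σ) ^ e i : ℂˣ) : ℂ)
  rw [Units.val_zpow_eq_zpow_val, Units.val_mk0, base, ← Complex.exp_int_mul, ← Complex.exp_add]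
  ring_nf

theorem translateUnit_shift_var (σ : ℂ) (l i : Fin r) :
    translateUnit (fun j => if j = l then 1 else 2) (var σ i) =
      var σ i * qC r σ ^ (if i = l then 1 else 2 : ℤ) := by
  rw [← translateUnit_var_intCast σ i fun j => if j = l then 1 else 2]
  congr 2
  funext j
  split_ifs <;> simp

theorem shiftMer_thVar (σ : ℂ) (τ : ℍ) (l i : Fin r) (m : ℤ) :
    shiftMer l (thVar σ τ i m) = thVar σ τ i (m + if i = l then 1 else 2) := by
  rw [shiftMer, thVar, translate_th, map_mul, map_zpow, translateUnit_qC, translateUnit_shift_var,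
    thVar, mul_assoc, ← zpow_add, add_comm]

theorem shiftMer_thRatio (σ : ℂ) (τ : ℍ) (l i j : Fin r) (m : ℤ) :
    shiftMer l (thRatio σ τ i j m) =
      thRatio σ τ i j (m + (if i = l then 1 else 2) - if j = l then 1 else 2) := by
  rw [shiftMer, thRatio, translate_th, map_div, map_mul, map_zpow, translateUnit_qC,
    translateUnit_shift_var, translateUnit_shift_var, thRatio]
  congr 1
  rw [zpow_sub, zpow_add]
  exact Additive.ofMul.injective (by simp only [ofMul_mul, ofMul_div, ofMul_inv]; abel)

theorem thRatio_swap (σ : ℂ) (τ : ℍ) (i j : Fin r) (m : ℤ) :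
    thRatio σ τ j i m =
      -((toMer (var σ i * qC r σ ^ (-m) / var σ j) : (Mer r)ˣ) : Mer r)⁻¹ *
        thRatio σ τ i j (-m) := by
  rw [thRatio, thRatio, ← th_inv]
  congr 1
  rw [zpow_neg]
  exact Additive.ofMul.injective (by simp only [ofMul_mul, ofMul_div, ofMul_inv]; abel)

theorem shiftMer_comm (i j : Fin r) (f : Mer r) :
    shiftMer i (shiftMer j f) = shiftMer j (shiftMer i f) := by
  rw [shiftMer, shiftMer, translate_translate, add_comm, ← translate_translate]

/-! ### The algebra as an algebra of difference operators -/

/-- The coefficient `θ(a_i q) / ∏_{j ≠ i} θ(a_i / a_j)` of the difference operator by which the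
variable `X_i` acts. -/
noncomputable def opCoeff (σ : ℂ) (τ : ℍ) (i : Fin r) : Mer r :=
  thVar σ τ i 1 / ∏ j ∈ Finset.univ.erase i, thRatio σ τ i j 0

theorem shiftMer_opCoeff {σ : ℂ} (hσ : σ ≠ 0) (τ : ℍ) {i j : Fin r} (hij : i ≠ j) :
    shiftMer j (opCoeff σ τ i) = opCoeff σ τ i *
      (thVar σ τ i 3 / thVar σ τ i 1 * (thRatio σ τ i j 0 / thRatio σ τ i j 1)) := by
  have hj : j ∈ Finset.univ.erase i := Finset.mem_erase.2 ⟨hij.symm, Finset.mem_univ j⟩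
  have h1 := thVar_ne_zero hσ τ i 1
  have h2 := thRatio_ne_zero hσ τ hij 0
  have h3 : ∏ l ∈ (Finset.univ.erase i).erase j, shiftMer j (thRatio σ τ i l 0) =
      ∏ l ∈ (Finset.univ.erase i).erase j, thRatio σ τ i l 0 := by
    refine Finset.prod_congr rfl fun l hl => ?_
    rw [shiftMer_thRatio, if_neg hij, if_neg (Finset.ne_of_mem_erase hl), add_sub_cancel_right]
  rw [opCoeff, ← Finset.mul_prod_erase _ _ hj, map_div₀, map_mul, map_prod, h3, shiftMer_thVar,
    shiftMer_thRatio, if_neg hij, if_pos rfl]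
  norm_num
  field_simp

/-- The difference operators attached to the variables satisfy the commutation relations. -/
theorem opCoeff_mul_shiftMer {σ : ℂ} (hσ : σ ≠ 0) (τ : ℍ) {i j : Fin r} (hij : i ≠ j) :
    opCoeff σ τ j * shiftMer j (opCoeff σ τ i) =
      smallWeight σ τ (var σ i) (var σ j) 1 1 *
        (opCoeff σ τ i * shiftMer i (opCoeff σ τ j)) := by
  have hw : smallWeight σ τ (var σ i) (var σ j) 1 1 =
      thVar σ τ i 3 * thVar σ τ j 1 * thRatio σ τ i j (-1) /
        (thVar σ τ i 1 * thVar σ τ j 3 * thRatio σ τ i j 1) * toMer (qC r σ) := rfl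
  rw [hw, shiftMer_opCoeff hσ τ hij, shiftMer_opCoeff hσ τ hij.symm, thRatio_swap σ τ i j 0,
    thRatio_swap σ τ i j 1]
  have hi1 := thVar_ne_zero hσ τ i 1
  have hj1 := thVar_ne_zero hσ τ j 1
  have hj3 := thVar_ne_zero hσ τ j 3
  have h0 := thRatio_ne_zero hσ τ hij 0
  have h1 := thRatio_ne_zero hσ τ hij 1
  have h2 := thRatio_ne_zero hσ τ hij (-1)
  have ha := (toMer (var σ i)).ne_zero
  have hb := (toMer (var σ j)).ne_zero
  have hq := (toMer (qC r σ)).ne_zero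
  simp only [neg_zero, zpow_zero, mul_one, zpow_neg_one, map_mul, map_div, map_inv, Units.val_mul,
    Units.val_div_eq_div_val, Units.val_inv_eq_inv_val]
  field_simp

/-- The operator by which `X_i` acts on the functions from exponent vectors to meromorphic
functions: the difference operator `opCoeff i • shiftMer i` on the values, combined with the shift
of the exponent vector which records the monomial. -/
noncomputable def opX (σ : ℂ) (τ : ℍ) (i : Fin r) : Module.End ℂ ((Fin r → ℕ) → Mer r) where
  toFun v k := if k i = 0 then 0 else opCoeff σ τ i * shiftMer i (v (k - Pi.single i 1))
  map_add' v w := by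
    funext k
    simp only [Pi.add_apply, map_add]
    split_ifs <;> ring
  map_smul' c v := by
    funext k
    simp only [Pi.smul_apply, map_smul, RingHom.id_apply]
    split_ifs <;> simp

/-- Multiplication by a totally elliptic function. -/
noncomputable def opC {σ : ℂ} {τ : ℍ} (f : TotallyElliptic r σ τ) :
    Module.End ℂ ((Fin r → ℕ) → Mer r) where
  toFun v k := (f : Mer r) * v k
  map_add' v w := by
    funext k
    simp [mul_add]
  map_smul' c v := by
    funext k
    simp

theorem opX_apply (σ : ℂ) (τ : ℍ) (i : Fin r) (v : (Fin r → ℕ) → Mer r) (k : Fin r → ℕ) :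
    opX σ τ i v k = if k i = 0 then 0 else opCoeff σ τ i * shiftMer i (v (k - Pi.single i 1)) :=
  rfl

theorem opC_apply {σ : ℂ} {τ : ℍ} (f : TotallyElliptic r σ τ) (v : (Fin r → ℕ) → Mer r)
    (k : Fin r → ℕ) : opC f v k = (f : Mer r) * v k :=
  rfl

theorem opX_mul_opX {σ : ℂ} (hσ : σ ≠ 0) (τ : ℍ) {i j : Fin r} (hij : i < j) :
    opX σ τ j * opX σ τ i = opC (weight hσ τ i j 1 1) * opX σ τ i * opX σ τ j := by
  refine LinearMap.ext fun v => funext fun k => ?_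
  simp only [Module.End.mul_apply, opX_apply, opC_apply]
  have e1 : (k - Pi.single j 1 : Fin r → ℕ) i = k i := by
    rw [Pi.sub_apply, Pi.single_eq_of_ne hij.ne, Nat.sub_zero]
  have e2 : (k - Pi.single i 1 : Fin r → ℕ) j = k j := by
    rw [Pi.sub_apply, Pi.single_eq_of_ne hij.ne', Nat.sub_zero]
  have e3 : k - Pi.single i 1 - Pi.single j 1 = k - Pi.single j 1 - Pi.single i 1 :=
    tsub_right_comm
  rw [e1, e2, e3]
  by_cases hi : k i = 0
  · simp [hi]
  by_cases hj : k j = 0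
  · simp [hj]
  have h := opCoeff_mul_shiftMer hσ τ hij.ne
  simp only [hi, hj, if_false, map_mul]
  rw [shiftMer_comm i j, ← mul_assoc, h]
  change _ = smallWeight σ τ (var σ i) (var σ j) 1 1 * _
  ring

/-- The action of the algebra of elliptic-commuting variables by difference operators. -/
noncomputable def rep {σ : ℂ} (hσ : σ ≠ 0) (τ : ℍ) :
    EllAlgebra r hσ τ →ₐ[ℂ] Module.End ℂ ((Fin r → ℕ) → Mer r) :=
  RingQuot.liftAlgHom ℂ ⟨FreeAlgebra.lift ℂ (Sum.elim (opX σ τ) opC), by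
    have hC (f : TotallyElliptic r σ τ) :
        FreeAlgebra.lift ℂ (Sum.elim (opX σ τ) opC) (Free.C f) = opC f :=
      FreeAlgebra.lift_ι_apply _ _
    have hX (i : Fin r) : FreeAlgebra.lift ℂ (Sum.elim (opX σ τ) (opC (σ := σ) (τ := τ)))
        (Free.X i) = opX σ τ i := FreeAlgebra.lift_ι_apply _ _
    intro x y h
    cases h with
    | add f g =>
      rw [map_add, hC, hC, hC]
      refine LinearMap.ext fun v => funext fun k => ?_
      exact add_mul (f : Mer r) g (v k)
    | mul f g =>
      rw [map_mul, hC, hC, hC]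
      refine LinearMap.ext fun v => funext fun k => ?_
      exact mul_assoc (f : Mer r) g (v k)
    | scalar c =>
      rw [hC, AlgHom.commutes]
      refine LinearMap.ext fun v => funext fun k => ?_
      exact (Algebra.smul_def c (v k)).symm
    | comm i j h =>
      rw [map_mul, map_mul, map_mul, hC, hX, hX, opX_mul_opX hσ τ h]
    | shift i f =>
      rw [map_mul, map_mul, hC, hC, hX]
      refine LinearMap.ext fun v => funext fun k => ?_
      simp only [Module.End.mul_apply, opX_apply, opC_apply, map_mul]
      change _ = shiftMer i (f : Mer r) * _
      split_ifs <;> ring⟩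

theorem rep_X {σ : ℂ} (hσ : σ ≠ 0) (τ : ℍ) (i : Fin r) : rep hσ τ (X hσ τ i) = opX σ τ i := by
  rw [rep, X, RingQuot.liftAlgHom_mkAlgHom_apply]
  exact FreeAlgebra.lift_ι_apply _ _

theorem rep_C {σ : ℂ} (hσ : σ ≠ 0) (τ : ℍ) (f : TotallyElliptic r σ τ) :
    rep hσ τ (C hσ τ f) = opC f := by
  change rep hσ τ (RingQuot.mkAlgHom ℂ (Rel hσ τ) (Free.C f)) = opC f
  rw [rep, RingQuot.liftAlgHom_mkAlgHom_apply]
  exact FreeAlgebra.lift_ι_apply _ _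

end Operators

/-! ### Coefficients of monomials and of powers under the action -/

section Coefficients

variable {r : ℕ}

/-- A product over pairs of indices to which only the pairs containing `i` contribute. -/
theorem prod_prod_ite_eq_prod_erase {M : Type*} [CommMonoid M] (i : Fin r) (G : Fin r → M) :
    ∏ l, ∏ m with l < m, (if l = i then G m else if m = i then G l else 1) =
      ∏ j ∈ Finset.univ.erase i, G j := by
  have h (l : Fin r) : ∏ m with l < m, (if l = i then G m else if m = i then G l else 1) =
      (if l = i then ∏ m with i < m, G m else 1) * (if l < i then G l else 1) := by
    by_cases hl : l = i
    · subst hl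
      simp
    · simp only [hl, if_false, one_mul]
      rw [Finset.prod_ite_eq']
      simp
  rw [Finset.prod_congr rfl fun l _ => h l, Finset.prod_mul_distrib, Finset.prod_ite_eq',
    if_pos (Finset.mem_univ i), ← Finset.prod_filter]
  rw [← Finset.prod_union (Finset.disjoint_filter.2 fun j _ h1 h2 => (h1.trans h2).false)]
  congr 1
  ext j
  simp only [Finset.mem_union, Finset.mem_filter, Finset.mem_univ, true_and, Finset.mem_erase,
    and_true]
  exact ⟨fun h => h.elim (fun h => h.ne') fun h => h.ne, fun h => (lt_or_gt_of_ne h).symm⟩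

/-- The contribution of the variable `a_i` alone to the action of the ordered monomial with
exponents `k`. -/
noncomputable def monomialVarFactor (σ : ℂ) (τ : ℍ) (k : Fin r → ℕ) (i : Fin r) : Mer r :=
  ∏ s ∈ Finset.range (k i), thVar σ τ i (1 + 2 * (∑ ν with ν < i, (k ν : ℤ)) + s)

/-- The contribution of the ratio of `a_i` and `a_j`, where `i < j`, to the denominator of the
action of the ordered monomial with exponents `k`. -/
noncomputable def monomialRatioFactor (σ : ℂ) (τ : ℍ) (k : Fin r → ℕ) (i j : Fin r) : Mer r :=
  (∏ s ∈ Finset.range (k j), thRatio σ τ j i (k i - s)) *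
    ∏ s ∈ Finset.range (k i), thRatio σ τ i j (-s)

/-- The function by which the ordered monomial with exponents `k` acts on the constant `1`. -/
noncomputable def monomialCoeff (σ : ℂ) (τ : ℍ) (k : Fin r → ℕ) : Mer r :=
  (∏ i, monomialVarFactor σ τ k i) / ∏ i, ∏ j with i < j, monomialRatioFactor σ τ k i j

theorem monomialRatioFactor_ne_zero {σ : ℂ} (hσ : σ ≠ 0) (τ : ℍ) (k : Fin r → ℕ) {i j : Fin r}
    (hij : i ≠ j) : monomialRatioFactor σ τ k i j ≠ 0 :=
  mul_ne_zero (Finset.prod_ne_zero_iff.2 fun _ _ => thRatio_ne_zero hσ τ hij.symm _)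
    (Finset.prod_ne_zero_iff.2 fun _ _ => thRatio_ne_zero hσ τ hij _)

theorem monomialCoeff_ne_zero {σ : ℂ} (hσ : σ ≠ 0) (τ : ℍ) (k : Fin r → ℕ) :
    monomialCoeff σ τ k ≠ 0 := by
  refine div_ne_zero (Finset.prod_ne_zero_iff.2 fun i _ => Finset.prod_ne_zero_iff.2 fun _ _ =>
    thVar_ne_zero hσ τ i _) (Finset.prod_ne_zero_iff.2 fun i _ => Finset.prod_ne_zero_iff.2
      fun j hj => monomialRatioFactor_ne_zero hσ τ k (Finset.mem_filter.1 hj).2.ne)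

theorem add_single_apply_self (k : Fin r → ℕ) (i : Fin r) :
    (k + Pi.single i 1 : Fin r → ℕ) i = k i + 1 := by simp

theorem add_single_apply_of_ne (k : Fin r → ℕ) {i l : Fin r} (h : l ≠ i) :
    (k + Pi.single i 1 : Fin r → ℕ) l = k l := by simp [h]

theorem sum_add_single (k : Fin r → ℕ) (i : Fin r) (s : Finset (Fin r)) :
    ∑ ν ∈ s, (((k + Pi.single i 1 : Fin r → ℕ) ν : ℕ) : ℤ) =
      (∑ ν ∈ s, (k ν : ℤ)) + if i ∈ s then 1 else 0 := by
  simp [Finset.sum_add_distrib, Pi.single_apply, Finset.sum_ite_eq']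

theorem shiftMer_monomialVarFactor (σ : ℂ) (τ : ℍ) {i : Fin r} {k : Fin r → ℕ}
    (h : ∀ l < i, k l = 0) (l : Fin r) :
    (if l = i then thVar σ τ i 1 else 1) * shiftMer i (monomialVarFactor σ τ k l) =
      monomialVarFactor σ τ (k + Pi.single i 1) l := by
  simp only [monomialVarFactor, map_prod, shiftMer_thVar, sum_add_single]
  rcases lt_trichotomy l i with hl | hl | hl
  · rw [add_single_apply_of_ne k hl.ne, h l hl, if_neg hl.ne]
    simp
  · subst hl
    have h0 : ∑ ν with ν < l, (k ν : ℤ) = 0 :=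
      Finset.sum_eq_zero fun ν hν => by simp [h ν (Finset.mem_filter.1 hν).2]
    rw [add_single_apply_self, Finset.prod_range_succ', mul_comm, h0]
    simp only [if_true, Finset.mem_filter, lt_irrefl, and_false, if_false]
    congr 1
  · rw [add_single_apply_of_ne k hl.ne', if_neg hl.ne', one_mul]
    refine Finset.prod_congr rfl fun s _ => ?_
    congr 1
    simp only [hl.ne', if_false, Finset.mem_filter, Finset.mem_univ, hl, and_self, if_true]
    ring

theorem shiftMer_monomialRatioFactor (σ : ℂ) (τ : ℍ) {i : Fin r} {k : Fin r → ℕ}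
    (h : ∀ l < i, k l = 0) {l m : Fin r} (hlm : l < m) :
    (if l = i then thRatio σ τ i m 0 else if m = i then thRatio σ τ i l 0 else 1) *
        shiftMer i (monomialRatioFactor σ τ k l m) =
      monomialRatioFactor σ τ (k + Pi.single i 1) l m := by
  simp only [monomialRatioFactor, map_mul, map_prod, shiftMer_thRatio]
  by_cases hl : l = i
  · subst hl
    rw [add_single_apply_self, add_single_apply_of_ne k hlm.ne', Finset.prod_range_succ',
      if_pos rfl, if_pos rfl, if_neg hlm.ne', ← mul_assoc, mul_comm (thRatio σ τ l m 0), mul_assoc,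
      mul_comm (thRatio σ τ l m 0)]
    congr 1
    · refine Finset.prod_congr rfl fun s _ => ?_
      congr 1
      push_cast
      ring
    · congr 1
      refine Finset.prod_congr rfl fun s _ => ?_
      congr 1
      push_cast
      ring
  · by_cases hm : m = i
    · subst hm
      rw [add_single_apply_self, add_single_apply_of_ne k hl, h l hlm, if_neg hl, if_pos rfl,
        if_neg hl, if_pos rfl, Finset.prod_range_succ']
      simp only [Finset.range_zero, Finset.prod_empty, mul_one]
      rw [mul_comm]
      congr 1
      refine Finset.prod_congr rfl fun s _ => ?_
      congr 1
      push_cast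
      ring
    · rw [add_single_apply_of_ne k hl, add_single_apply_of_ne k hm]
      simp only [hl, hm, if_false, one_mul, add_sub_cancel_right]

/-- The operator of `X_i` maps the function of a monomial in which no variable precedes `X_i` to the
function of the next monomial. -/
theorem opCoeff_mul_shiftMer_monomialCoeff (σ : ℂ) (τ : ℍ) {i : Fin r} {k : Fin r → ℕ}
    (h : ∀ l < i, k l = 0) :
    opCoeff σ τ i * shiftMer i (monomialCoeff σ τ k) =
      monomialCoeff σ τ (k + Pi.single i 1) := by
  have h1 : thVar σ τ i 1 * ∏ l, shiftMer i (monomialVarFactor σ τ k l) =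
      ∏ l, monomialVarFactor σ τ (k + Pi.single i 1) l := by
    rw [← Finset.prod_congr rfl fun l _ => shiftMer_monomialVarFactor σ τ h l,
      Finset.prod_mul_distrib, Finset.prod_ite_eq', if_pos (Finset.mem_univ i)]
  have h2 : (∏ j ∈ Finset.univ.erase i, thRatio σ τ i j 0) *
      ∏ l, ∏ m with l < m, shiftMer i (monomialRatioFactor σ τ k l m) =
      ∏ l, ∏ m with l < m, monomialRatioFactor σ τ (k + Pi.single i 1) l m := by
    rw [← prod_prod_ite_eq_prod_erase, ← Finset.prod_mul_distrib]
    refine Finset.prod_congr rfl fun l _ => ?_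
    rw [← Finset.prod_mul_distrib]
    exact Finset.prod_congr rfl fun m hm =>
      shiftMer_monomialRatioFactor σ τ h (Finset.mem_filter.1 hm).2
  rw [monomialCoeff, opCoeff, map_div₀, div_mul_div_comm]
  simp only [map_prod]
  rw [h1, h2, monomialCoeff]

theorem monomialCoeff_zero (σ : ℂ) (τ : ℍ) : monomialCoeff σ τ (0 : Fin r → ℕ) = 1 := by
  simp [monomialCoeff, monomialVarFactor, monomialRatioFactor]

theorem opX_single (σ : ℂ) (τ : ℍ) (i : Fin r) (k : Fin r → ℕ) (f : Mer r) :
    opX σ τ i (Pi.single k f) = Pi.single (k + Pi.single i 1) (opCoeff σ τ i * shiftMer i f) := by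
  funext k'
  rw [opX_apply]
  by_cases h : k' = k + Pi.single i 1
  · subst h
    rw [if_neg (by simp), add_tsub_cancel_right, Pi.single_eq_same, Pi.single_eq_same]
  · rw [Pi.single_eq_of_ne h]
    split_ifs with h0
    · rfl
    · have : k' - Pi.single i 1 ≠ k := by
        rintro rfl
        refine h (tsub_add_cancel_of_le ?_).symm
        intro l
        by_cases hl : l = i
        · subst hl
          simpa using Nat.one_le_iff_ne_zero.2 h0
        · simp [hl]
      rw [Pi.single_eq_of_ne this, map_zero, mul_zero]

/-- Every nonzero exponent vector arises by raising the exponent of its first variable. -/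
theorem exists_eq_add_single {k : Fin r → ℕ} (hk : k ≠ 0) :
    ∃ (i : Fin r) (k' : Fin r → ℕ), k = k' + Pi.single i 1 ∧ ∀ l < i, k' l = 0 := by
  have hne : ((Finset.univ : Finset (Fin r)).filter fun i => k i ≠ 0).Nonempty := by
    obtain ⟨i, hi⟩ := Function.ne_iff.1 hk
    exact ⟨i, by simpa using hi⟩
  set i := Finset.min' _ hne
  have hi : k i ≠ 0 := (Finset.mem_filter.1 (Finset.min'_mem _ hne)).2
  have hle : Pi.single i 1 ≤ k := by
    intro l
    by_cases hl : l = i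
    · rw [hl, Pi.single_eq_same]
      exact Nat.one_le_iff_ne_zero.2 hi
    · simp [hl]
  refine ⟨i, k - Pi.single i 1, (tsub_add_cancel_of_le hle).symm, fun l hl => ?_⟩
  have hl0 : k l = 0 := by
    by_contra h0
    exact absurd (Finset.min'_le _ l (by simpa using h0)) (not_le.2 hl)
  simp [hl0]

theorem rep_monomial {σ : ℂ} (hσ : σ ≠ 0) (τ : ℍ) (k : Fin r → ℕ) :
    rep hσ τ (monomial hσ τ k) (Pi.single 0 1) = Pi.single k (monomialCoeff σ τ k) := by
  induction hn : ∑ i, k i generalizing k with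
  | zero =>
    have : k = 0 := funext fun i => by
      simpa using (Finset.sum_eq_zero_iff.1 hn) i (Finset.mem_univ i)
    rw [this, monomial_zero, map_one, monomialCoeff_zero]
    rfl
  | succ n ih =>
    have hk : k ≠ 0 := by
      rintro rfl
      simp at hn
    obtain ⟨i, k', rfl, hk'⟩ := exists_eq_add_single hk
    rw [← X_mul_monomial_of_lt hσ τ hk', map_mul, rep_X, Module.End.mul_apply, ih k' ?_, opX_single,
      opCoeff_mul_shiftMer_monomialCoeff σ τ hk']
    simpa [Finset.sum_add_distrib] using hn

/-- The action of a normal form on the constant `1` determines its coefficients. -/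
theorem rep_normal_form {σ : ℂ} (hσ : σ ≠ 0) (τ : ℍ)
    (f : (Fin r → ℕ) →₀ TotallyElliptic r σ τ) (k : Fin r → ℕ) :
    rep hσ τ (f.sum fun k g => C hσ τ g * monomial hσ τ k) (Pi.single 0 1) k =
      (f k : Mer r) * monomialCoeff σ τ k := by
  have h (k' : Fin r → ℕ) : rep hσ τ (C hσ τ (f k') * monomial hσ τ k') (Pi.single 0 1) k =
      if k = k' then (f k : Mer r) * monomialCoeff σ τ k else 0 := by
    rw [map_mul, rep_C, Module.End.mul_apply, rep_monomial, opC_apply]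
    split_ifs with hk
    · subst hk
      rw [Pi.single_eq_same]
    · rw [Pi.single_eq_of_ne hk, mul_zero]
  rw [Finsupp.sum, map_sum, LinearMap.sum_apply, Finset.sum_apply,
    Finset.sum_congr rfl fun k' _ => h k', Finset.sum_ite_eq]
  split_ifs with hk
  · rfl
  · rw [Finsupp.notMem_support_iff.1 hk]
    simp

theorem normal_form_injective {σ : ℂ} (hσ : σ ≠ 0) (τ : ℍ)
    {f g : (Fin r → ℕ) →₀ TotallyElliptic r σ τ}
    (h : (f.sum fun k g => C hσ τ g * monomial hσ τ k) =
      g.sum fun k g => C hσ τ g * monomial hσ τ k) : f = g := by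
  refine Finsupp.ext fun k => Subtype.ext ?_
  refine mul_right_cancel₀ (monomialCoeff_ne_zero hσ τ k) ?_
  rw [← rep_normal_form hσ, ← rep_normal_form hσ, h]

end Coefficients

/-! ### The multinomial expansion of the difference operators -/

section Expansion

variable {r : ℕ}

/-- The quotient `(q; q, p)_n / ∏ (q; q, p)_{k_i}` of theta factorials, where `n = ∑ k_i`. -/
noncomputable def powerConstFactor (σ : ℂ) (τ : ℍ) (k : Fin r → ℕ) : Mer r :=
  thetaFactorial σ τ (qC r σ) (∑ ν, k ν) / ∏ i, thetaFactorial σ τ (qC r σ) (k i)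

/-- The contribution of the variable `a_i` alone to the action of a power of `∑ X_i`. -/
noncomputable def powerVarFactor (σ : ℂ) (τ : ℍ) (k : Fin r → ℕ) (i : Fin r) : Mer r :=
  ∏ s ∈ Finset.range (k i), thVar σ τ i (1 + (∑ ν, (k ν : ℤ)) - k i + s)

/-- The contribution of the ratio of `a_i` and `a_j`, where `i < j`, to the action of a power of
`∑ X_i`. -/
noncomputable def powerRatioFactor (σ : ℂ) (τ : ℍ) (k : Fin r → ℕ) (i j : Fin r) : Mer r :=
  (∏ s ∈ Finset.range (k j), thRatio σ τ i j (1 - k i + s)) /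
    ((∏ s ∈ Finset.range (k j), thRatio σ τ i j (1 + s)) * monomialRatioFactor σ τ k i j)

/-- The coefficient with index `k` of the action of `(∑ X_i) ^ n` on the constant `1`, where
`n = ∑ k_i`. -/
noncomputable def powerCoeff (σ : ℂ) (τ : ℍ) (k : Fin r → ℕ) : Mer r :=
  powerConstFactor σ τ k * (∏ i, powerVarFactor σ τ k i) *
    ∏ i, ∏ j with i < j, powerRatioFactor σ τ k i j

/-- The theta factorials `(a_i q ^ {1 + 2 K_{i-1}})_{k_i}`, which depend on the ordering of the
variables, cancel. -/
theorem ellMultinomial_mul_monomialCoeff {σ : ℂ} (hσ : σ ≠ 0) (τ : ℍ) (k : Fin r → ℕ) :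
    ellMultinomial σ τ k * monomialCoeff σ τ k = powerCoeff σ τ k := by
  have hv (i : Fin r) (m : ℤ) (n : ℕ) : thetaFactorial σ τ (var σ i * qC r σ ^ m) n =
      ∏ s ∈ Finset.range n, thVar σ τ i (m + s) := by
    refine Finset.prod_congr rfl fun s _ => ?_
    rw [thVar, zpow_add, zpow_natCast, mul_assoc]
  have hd (i j : Fin r) (m : ℤ) (n : ℕ) : thetaFactorial σ τ (var σ i * qC r σ ^ m / var σ j) n =
      ∏ s ∈ Finset.range n, thRatio σ τ i j (m + s) := by
    refine Finset.prod_congr rfl fun s _ => ?_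
    rw [thRatio, zpow_add, zpow_natCast, ← mul_assoc, div_mul_eq_mul_div]
  have hd1 (i j : Fin r) (n : ℕ) : thetaFactorial σ τ (var σ i * qC r σ / var σ j) n =
      ∏ s ∈ Finset.range n, thRatio σ τ i j (1 + s) := by
    rw [← hd, zpow_one]
  have hne : ∏ i, monomialVarFactor σ τ k i ≠ 0 := Finset.prod_ne_zero_iff.2 fun i _ =>
    Finset.prod_ne_zero_iff.2 fun _ _ => thVar_ne_zero hσ τ i _
  have h1 : ∏ i, (∏ s ∈ Finset.range (k i), thVar σ τ i (1 + (∑ ν, (k ν : ℤ)) - k i + s)) /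
      (∏ s ∈ Finset.range (k i), thVar σ τ i (1 + 2 * (∑ ν with ν < i, (k ν : ℤ)) + s)) =
      (∏ i, powerVarFactor σ τ k i) / ∏ i, monomialVarFactor σ τ k i :=
    Finset.prod_div_distrib _ _
  have h2 : ∏ i, ∏ j with i < j, powerRatioFactor σ τ k i j =
      (∏ i, ∏ j with i < j, (∏ s ∈ Finset.range (k j), thRatio σ τ i j (1 - k i + s)) /
        (∏ s ∈ Finset.range (k j), thRatio σ τ i j (1 + s))) /
        ∏ i, ∏ j with i < j, monomialRatioFactor σ τ k i j := by
    rw [← Finset.prod_div_distrib]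
    refine Finset.prod_congr rfl fun i _ => ?_
    rw [← Finset.prod_div_distrib]
    refine Finset.prod_congr rfl fun j _ => ?_
    rw [powerRatioFactor, div_div]
  simp only [ellMultinomial, hv, hd, hd1]
  rw [h1, powerCoeff, h2, monomialCoeff, powerConstFactor]
  field_simp

theorem shiftMer_th_qC_pow (σ : ℂ) (τ : ℍ) (i : Fin r) (m : ℕ) :
    shiftMer i (th τ (qC r σ ^ m)) = th τ (qC r σ ^ m) := by
  rw [shiftMer, translate_th, map_pow, translateUnit_qC]

theorem thetaFactorial_qC (σ : ℂ) (τ : ℍ) (n : ℕ) :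
    thetaFactorial σ τ (qC r σ) n = ∏ s ∈ Finset.range n, th τ (qC r σ ^ (s + 1)) :=
  Finset.prod_congr rfl fun s _ => by rw [pow_succ']

theorem shiftMer_powerConstFactor (σ : ℂ) (τ : ℍ) (i : Fin r) (k : Fin r → ℕ) :
    shiftMer i (powerConstFactor σ τ k) = powerConstFactor σ τ k := by
  simp only [powerConstFactor, thetaFactorial_qC, map_div₀, map_prod, shiftMer_th_qC_pow]

theorem powerConstFactor_add_single (σ : ℂ) (τ : ℍ) (i : Fin r) (k : Fin r → ℕ)
    (h : th τ (qC r σ ^ (k i + 1)) ≠ 0) :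
    powerConstFactor σ τ k * th τ (qC r σ ^ (∑ ν, k ν + 1)) =
      powerConstFactor σ τ (k + Pi.single i 1) * th τ (qC r σ ^ (k i + 1)) := by
  have hs : ∑ ν, (k + Pi.single i 1 : Fin r → ℕ) ν = ∑ ν, k ν + 1 := by
    simp [Finset.sum_add_distrib]
  have h1 : ∏ l, thetaFactorial σ τ (qC r σ) ((k + Pi.single i 1 : Fin r → ℕ) l) =
      (∏ l, thetaFactorial σ τ (qC r σ) (k l)) * th τ (qC r σ ^ (k i + 1)) := by
    have (l : Fin r) : thetaFactorial σ τ (qC r σ) ((k + Pi.single i 1 : Fin r → ℕ) l) =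
        thetaFactorial σ τ (qC r σ) (k l) * if l = i then th τ (qC r σ ^ (k i + 1)) else 1 := by
      by_cases hl : l = i
      · subst hl
        rw [add_single_apply_self, thetaFactorial_qC, Finset.prod_range_succ, ← thetaFactorial_qC,
          if_pos rfl]
      · rw [add_single_apply_of_ne k hl, if_neg hl, mul_one]
    rw [Finset.prod_congr rfl fun l _ => this l, Finset.prod_mul_distrib, Finset.prod_ite_eq',
      if_pos (Finset.mem_univ i)]
  rw [powerConstFactor, powerConstFactor, h1, hs, thetaFactorial_qC σ τ (_ + 1),
    Finset.prod_range_succ, ← thetaFactorial_qC, div_mul_eq_mul_div, div_mul_eq_mul_div,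
    mul_div_mul_right _ _ h]

theorem shiftMer_powerVarFactor (σ : ℂ) (τ : ℍ) (i : Fin r) (k : Fin r → ℕ) (l : Fin r) :
    shiftMer i (powerVarFactor σ τ k l) *
        thVar σ τ l (1 + (∑ ν, ((k + Pi.single i 1 : Fin r → ℕ) ν : ℤ)) -
          (k + Pi.single i 1 : Fin r → ℕ) l) =
      powerVarFactor σ τ (k + Pi.single i 1) l *
        if l = i then 1 else thVar σ τ l (1 + ∑ ν, ((k + Pi.single i 1 : Fin r → ℕ) ν : ℤ)) := by
  simp only [powerVarFactor, map_prod, shiftMer_thVar, sum_add_single, Finset.mem_univ, if_true]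
  by_cases hl : l = i
  · subst hl
    rw [add_single_apply_self, Finset.prod_range_succ']
    simp only [if_true, mul_one]
    congr 1
    · refine Finset.prod_congr rfl fun s _ => ?_
      congr 1
      push_cast
      ring
    · congr 1
      push_cast
      ring
  · rw [add_single_apply_of_ne k hl]
    simp only [hl, if_false]
    have h := (Finset.prod_range_succ
      (fun s : ℕ => thVar σ τ l (1 + ((∑ ν, (k ν : ℤ)) + 1) - k l + s)) (k l)).symm.trans
      (Finset.prod_range_succ' _ (k l))
    rw [show 1 + ((∑ ν, (k ν : ℤ)) + 1) - k l + (k l : ℕ) = 1 + ((∑ ν, (k ν : ℤ)) + 1) by ring] at h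
    rw [h]
    congr 1
    · refine Finset.prod_congr rfl fun s _ => ?_
      congr 1
      push_cast
      ring
    · congr 1
      push_cast
      ring

/-- The effect of `X_i` on the factor of a pair. The two cases `l = i` and `m = i` lead to the same
quotient `θ(a_i q ^ {k_j} / a_j)`, where `j` is the other index of the pair. -/
theorem shiftMer_powerRatioFactor {σ : ℂ} (hσ : σ ≠ 0) (τ : ℍ) (i : Fin r) (k : Fin r → ℕ)
    {l m : Fin r} (hlm : l < m) :
    shiftMer i (powerRatioFactor σ τ k l m) =
      powerRatioFactor σ τ (k + Pi.single i 1) l m *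
        if l = i then thRatio σ τ i m (k m) else if m = i then thRatio σ τ i l (k l) else 1 := by
  simp only [powerRatioFactor, monomialRatioFactor, map_div₀, map_mul, map_prod, shiftMer_thRatio]
  by_cases hl : l = i
  · subst hl
    have hne (e : ℤ) := thRatio_ne_zero hσ τ hlm.ne e
    have hne' (e : ℤ) := thRatio_ne_zero hσ τ hlm.ne' e
    rw [add_single_apply_self, add_single_apply_of_ne k hlm.ne']
    simp only [hlm.ne', if_true, if_false]
    have a1 : ∏ s ∈ Finset.range (k m), thRatio σ τ l m (1 - k l + s + 1 - 2) =
        ∏ s ∈ Finset.range (k m), thRatio σ τ l m (1 - (k l + 1 : ℕ) + s) :=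
      Finset.prod_congr rfl fun s _ => by congr 1; push_cast; ring
    have a2 : (∏ s ∈ Finset.range (k m), thRatio σ τ l m (1 + s + 1 - 2)) *
        thRatio σ τ l m (k m) =
        (∏ s ∈ Finset.range (k m), thRatio σ τ l m (1 + s)) * thRatio σ τ l m 0 := by
      have h := (Finset.prod_range_succ (fun s : ℕ => thRatio σ τ l m s) (k m)).symm.trans
        (Finset.prod_range_succ' _ (k m))
      rw [show ∏ s ∈ Finset.range (k m), thRatio σ τ l m (1 + s + 1 - 2) =
        ∏ s ∈ Finset.range (k m), thRatio σ τ l m s from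
        Finset.prod_congr rfl fun s _ => by congr 1; ring, h]
      congr 1
      exact Finset.prod_congr rfl fun s _ => by congr 1; push_cast; ring
    have a3 : ∏ s ∈ Finset.range (k m), thRatio σ τ m l (k l - s + 2 - 1) =
        ∏ s ∈ Finset.range (k m), thRatio σ τ m l ((k l + 1 : ℕ) - s) :=
      Finset.prod_congr rfl fun s _ => by congr 1; push_cast; ring
    have a4 : (∏ s ∈ Finset.range (k l), thRatio σ τ l m (-s + 1 - 2)) * thRatio σ τ l m 0 =
        ∏ s ∈ Finset.range (k l + 1), thRatio σ τ l m (-s) := by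
      rw [Finset.prod_range_succ']
      congr 1
      exact Finset.prod_congr rfl fun s _ => by congr 1; push_cast; ring
    rw [a1, a3, ← a4]
    have n0 := hne 0
    have n1 : ∏ s ∈ Finset.range (k m), thRatio σ τ l m (1 + s + 1 - 2) ≠ 0 :=
      Finset.prod_ne_zero_iff.2 fun _ _ => hne _
    have n2 : ∏ s ∈ Finset.range (k m), thRatio σ τ l m (1 + s) ≠ 0 :=
      Finset.prod_ne_zero_iff.2 fun _ _ => hne _
    have n3 : ∏ s ∈ Finset.range (k m), thRatio σ τ m l ((k l + 1 : ℕ) - s) ≠ 0 :=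
      Finset.prod_ne_zero_iff.2 fun _ _ => hne' _
    have n4 : ∏ s ∈ Finset.range (k l), thRatio σ τ l m (-s + 1 - 2) ≠ 0 :=
      Finset.prod_ne_zero_iff.2 fun _ _ => hne _
    have key (N E E' D G z t : Mer r) (hE : E ≠ 0) (hE' : E' ≠ 0) (hD : D ≠ 0) (hG : G ≠ 0)
        (hz : z ≠ 0) (h : E * t = E' * z) :
        N / (E * (D * G)) = N / (E' * (D * (G * z))) * t := by
      field_simp
      linear_combination -N * h
    exact key _ _ _ _ _ _ _ n1 n2 n3 n4 n0 a2
  · by_cases hm : m = i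
    · subst hm
      have hne (e : ℤ) := thRatio_ne_zero hσ τ hlm.ne e
      have hne' (e : ℤ) := thRatio_ne_zero hσ τ hlm.ne' e
      rw [add_single_apply_self, add_single_apply_of_ne k hl]
      simp only [hl, if_true, if_false]
      have b1 : ∏ s ∈ Finset.range (k m + 1), thRatio σ τ l m (1 - k l + s) =
          (∏ s ∈ Finset.range (k m), thRatio σ τ l m (1 - k l + s + 2 - 1)) *
            thRatio σ τ l m (1 - k l) := by
        rw [Finset.prod_range_succ', Nat.cast_zero, add_zero]
        congr 1
        exact Finset.prod_congr rfl fun s _ => by congr 1; push_cast; ring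
      have b2 : ∏ s ∈ Finset.range (k m + 1), thRatio σ τ l m (1 + s) =
          (∏ s ∈ Finset.range (k m), thRatio σ τ l m (1 + s + 2 - 1)) * thRatio σ τ l m 1 := by
        rw [Finset.prod_range_succ', Nat.cast_zero, add_zero]
        congr 1
        exact Finset.prod_congr rfl fun s _ => by congr 1; push_cast; ring
      have b3 : ∏ s ∈ Finset.range (k m + 1), thRatio σ τ m l (k l - s) =
          (∏ s ∈ Finset.range (k m), thRatio σ τ m l (k l - s + 1 - 2)) *
            thRatio σ τ m l (k l) := by
        rw [Finset.prod_range_succ', Nat.cast_zero, sub_zero]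
        congr 1
        exact Finset.prod_congr rfl fun s _ => by congr 1; push_cast; ring
      have b4 : (∏ s ∈ Finset.range (k l), thRatio σ τ l m (-s + 2 - 1)) *
          thRatio σ τ l m (1 - k l) =
          (∏ s ∈ Finset.range (k l), thRatio σ τ l m (-s)) * thRatio σ τ l m 1 := by
        have h := (Finset.prod_range_succ (fun s : ℕ => thRatio σ τ l m (1 - s)) (k l)).symm.trans
          (Finset.prod_range_succ' _ (k l))
        rw [Nat.cast_zero, sub_zero] at h
        rw [show ∏ s ∈ Finset.range (k l), thRatio σ τ l m (-s + 2 - 1) =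
          ∏ s ∈ Finset.range (k l), thRatio σ τ l m (1 - s) from
          Finset.prod_congr rfl fun s _ => by congr 1; ring, h]
        congr 1
        exact Finset.prod_congr rfl fun s _ => by congr 1; push_cast; ring
      rw [b1, b2, b3]
      have n1 : ∏ s ∈ Finset.range (k m), thRatio σ τ l m (1 + s + 2 - 1) ≠ 0 :=
        Finset.prod_ne_zero_iff.2 fun _ _ => hne _
      have n2 : ∏ s ∈ Finset.range (k m), thRatio σ τ m l (k l - s + 1 - 2) ≠ 0 :=
        Finset.prod_ne_zero_iff.2 fun _ _ => hne' _
      have n3 : ∏ s ∈ Finset.range (k l), thRatio σ τ l m (-s + 2 - 1) ≠ 0 :=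
        Finset.prod_ne_zero_iff.2 fun _ _ => hne _
      have n4 : ∏ s ∈ Finset.range (k l), thRatio σ τ l m (-s) ≠ 0 :=
        Finset.prod_ne_zero_iff.2 fun _ _ => hne _
      have key (N E D G G' c u t : Mer r) (hE : E ≠ 0) (hD : D ≠ 0) (hG : G ≠ 0) (hG' : G' ≠ 0)
          (hu : u ≠ 0) (ht : t ≠ 0) (h : G * c = G' * u) :
          N / (E * (D * G)) = N * c / (E * u * (D * t * G')) * t := by
        field_simp
        linear_combination -N * h
      exact key _ _ _ _ _ _ _ _ n1 n2 n3 n4 (hne 1) (hne' (k l)) b4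
    · simp only [add_single_apply_of_ne k hl, add_single_apply_of_ne k hm, hl, hm, if_false,
        mul_one, add_sub_cancel_right]

/-- The quotient of the summand with index `i` in the recursion for `powerCoeff σ τ k` by
`powerCoeff σ τ k` itself. It vanishes if `k i = 0`. -/
noncomputable def recursionWeight (σ : ℂ) (τ : ℍ) (k : Fin r → ℕ) (i : Fin r) : Mer r :=
  thVar σ τ i 1 * th τ (qC r σ ^ k i) / th τ (qC r σ ^ ∑ ν, k ν) *
    (∏ j ∈ Finset.univ.erase i, thRatio σ τ i j (k j) / thRatio σ τ i j 0) *
    ∏ j, (if j = i then 1 else thVar σ τ j (1 + ∑ ν, (k ν : ℤ))) /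
      thVar σ τ j (1 + (∑ ν, (k ν : ℤ)) - k j)

theorem recursionWeight_eq_zero (σ : ℂ) (τ : ℍ) {k : Fin r → ℕ} {i : Fin r} (h : k i = 0) :
    recursionWeight σ τ k i = 0 := by
  simp [recursionWeight, h, th_one]

theorem opCoeff_mul_shiftMer_powerCoeff {σ : ℂ} (hσ : σ ≠ 0) (τ : ℍ) (k : Fin r → ℕ) (i : Fin r)
    (h : th τ (qC r σ ^ (k i + 1)) ≠ 0) (h' : th τ (qC r σ ^ (∑ ν, k ν + 1)) ≠ 0) :
    opCoeff σ τ i * shiftMer i (powerCoeff σ τ k) =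
      powerCoeff σ τ (k + Pi.single i 1) * recursionWeight σ τ (k + Pi.single i 1) i := by
  set k' : Fin r → ℕ := k + Pi.single i 1 with hk'
  have hs : ∑ ν, k' ν = ∑ ν, k ν + 1 := by
    simp [hk', Finset.sum_add_distrib]
  have hi : k' i = k i + 1 := add_single_apply_self k i
  have hconst := powerConstFactor_add_single σ τ i k h
  have hvar : (∏ l, shiftMer i (powerVarFactor σ τ k l)) *
      ∏ l, thVar σ τ l (1 + (∑ ν, (k' ν : ℤ)) - k' l) =
      (∏ l, powerVarFactor σ τ k' l) *
        ∏ l, if l = i then 1 else thVar σ τ l (1 + ∑ ν, (k' ν : ℤ)) := by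
    rw [← Finset.prod_mul_distrib, ← Finset.prod_mul_distrib]
    exact Finset.prod_congr rfl fun l _ => shiftMer_powerVarFactor σ τ i k l
  have hratio : ∏ l, ∏ m with l < m, shiftMer i (powerRatioFactor σ τ k l m) =
      (∏ l, ∏ m with l < m, powerRatioFactor σ τ k' l m) *
        ∏ j ∈ Finset.univ.erase i, thRatio σ τ i j (k' j) := by
    have he : ∏ j ∈ Finset.univ.erase i, thRatio σ τ i j (k' j) =
        ∏ j ∈ Finset.univ.erase i, thRatio σ τ i j (k j) :=
      Finset.prod_congr rfl fun j hj => by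
        rw [hk', add_single_apply_of_ne k (Finset.ne_of_mem_erase hj)]
    rw [he, ← prod_prod_ite_eq_prod_erase, ← Finset.prod_mul_distrib]
    refine Finset.prod_congr rfl fun l _ => ?_
    rw [← Finset.prod_mul_distrib]
    exact Finset.prod_congr rfl fun m hm =>
      shiftMer_powerRatioFactor hσ τ i k (Finset.mem_filter.1 hm).2
  have n1 : ∏ l, thVar σ τ l (1 + (∑ ν, (k' ν : ℤ)) - k' l) ≠ 0 :=
    Finset.prod_ne_zero_iff.2 fun l _ => thVar_ne_zero hσ τ l _
  have n2 : ∏ j ∈ Finset.univ.erase i, thRatio σ τ i j 0 ≠ 0 :=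
    Finset.prod_ne_zero_iff.2 fun j hj => thRatio_ne_zero hσ τ (Finset.ne_of_mem_erase hj).symm _
  rw [powerCoeff, map_mul, map_mul, shiftMer_powerConstFactor]
  simp only [map_prod]
  rw [hratio, opCoeff, powerCoeff, recursionWeight, hs, hi, Finset.prod_div_distrib,
    Finset.prod_div_distrib]
  have key (t D c c' V V' U U' P G e e' : Mer r) (hD : D ≠ 0) (hU : U ≠ 0) (he : e ≠ 0)
      (hc : c * e = c' * e') (hV : V * U = V' * U') :
      t / D * (c * V * (P * G)) = c' * V' * P * (t * e' / e * (G / D) * (U' / U)) := by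
    field_simp
    linear_combination (t * P * G * V * U) * hc + (t * P * G * c' * e') * hV
  exact key _ _ _ _ _ _ _ _ _ _ _ _ n2 n1 h' hconst hvar

/-- The recursion weights with `k i ≠ 0` are the summands of the partial fraction expansion with poles
`a_i q` and `z_i = q ^ {k_i}`. The indices with `k i = 0` have to be left out there, because
`θ(q ^ 0) = 0`. -/
theorem sum_recursionWeight {σ : ℂ} (hσ : σ ≠ 0) (τ : ℍ) (k : Fin r → ℕ) (hk : 0 < ∑ ν, k ν)
    (hq : ∀ m, 1 ≤ m → m ≤ ∑ ν, k ν → th τ (qC r σ ^ m) ≠ 0) :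
    ∑ i, recursionWeight σ τ k i = 1 := by
  set s : Finset (Fin r) := Finset.univ.filter fun i => k i ≠ 0 with hsdef
  have hs : s.Nonempty := by
    obtain ⟨i, -, hi⟩ := Finset.exists_ne_zero_of_sum_ne_zero hk.ne'
    exact ⟨i, Finset.mem_filter.2 ⟨Finset.mem_univ i, hi⟩⟩
  have hns {j : Fin r} (hj : j ∉ s) : k j = 0 := by simpa [hsdef] using hj
  have hZ : ∏ j ∈ s, qC r σ ^ k j = qC r σ ^ ∑ ν, k ν := by
    rw [Finset.prod_pow_eq_pow_sum, hsdef, Finset.sum_filter_ne_zero]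
  have e1 (i : Fin r) : th τ (var σ i * qC r σ) = thVar σ τ i 1 := by rw [thVar, zpow_one]
  have e2 (i j : Fin r) : th τ (var σ i * qC r σ / (var σ j * qC r σ)) = thRatio σ τ i j 0 := by
    rw [thRatio, zpow_zero, mul_one, mul_div_mul_right_eq_div]
  have e3 (i j : Fin r) : th τ (var σ i * qC r σ * qC r σ ^ k j / (var σ j * qC r σ)) =
      thRatio σ τ i j (k j) := by
    rw [thRatio, zpow_natCast, mul_right_comm, mul_div_mul_right_eq_div]
  have e4 (i : Fin r) : th τ (var σ i * qC r σ * qC r σ ^ ∑ ν, k ν) =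
      thVar σ τ i (1 + ∑ ν, (k ν : ℤ)) := by
    rw [thVar, zpow_add, zpow_one, ← Nat.cast_sum, zpow_natCast, mul_assoc]
  have e5 (i : Fin r) : th τ (var σ i * qC r σ * qC r σ ^ (∑ ν, k ν) / qC r σ ^ k i) =
      thVar σ τ i (1 + (∑ ν, (k ν : ℤ)) - k i) := by
    rw [thVar, zpow_sub, zpow_add, zpow_one, ← Nat.cast_sum, zpow_natCast, zpow_natCast,
      ← mul_assoc, ← mul_assoc, ← div_eq_mul_inv]
  have h := sum_th_div_eq_one τ (fun i => var σ i * qC r σ) (fun i => qC r σ ^ k i) s hs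
    (fun i _ j _ hij => by
      rw [e2]
      exact thRatio_ne_zero hσ τ hij 0)
    (fun t ht ⟨i, hi⟩ => by
      rw [Finset.prod_pow_eq_pow_sum]
      refine hq _ ?_ (Finset.sum_le_sum_of_subset (Finset.subset_univ t))
      exact (Nat.one_le_iff_ne_zero.2 (Finset.mem_filter.1 (ht hi)).2).trans
        (Finset.single_le_sum (fun _ _ => Nat.zero_le _) hi))
    (fun i _ => by
      rw [hZ, e4]
      exact thVar_ne_zero hσ τ i _)
    (fun i _ => by
      rw [hZ, e5]
      exact thVar_ne_zero hσ τ i _)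
  simp only [hZ, e1, e2, e3, e4, e5] at h
  rw [← h, ← Finset.sum_subset (Finset.subset_univ s) fun i _ hi =>
    recursionWeight_eq_zero σ τ (hns hi)]
  refine Finset.sum_congr rfl fun i hi => ?_
  -- the indices `j` with `k j = 0` contribute trivial factors
  have p1 : ∏ j ∈ s.erase i, thRatio σ τ i j (k j) / thRatio σ τ i j 0 =
      ∏ j ∈ Finset.univ.erase i, thRatio σ τ i j (k j) / thRatio σ τ i j 0 := by
    refine Finset.prod_subset (Finset.erase_subset_erase i (Finset.subset_univ s)) fun j hj hjs => ?_
    have hji := Finset.ne_of_mem_erase hj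
    rw [hns fun hjs' => hjs (Finset.mem_erase.2 ⟨hji, hjs'⟩), Nat.cast_zero,
      div_self (thRatio_ne_zero hσ τ hji.symm 0)]
  have p2 : ∏ j ∈ s, thVar σ τ j (1 + ∑ ν, (k ν : ℤ)) / thVar σ τ j (1 + (∑ ν, (k ν : ℤ)) - k j) =
      ∏ j, thVar σ τ j (1 + ∑ ν, (k ν : ℤ)) / thVar σ τ j (1 + (∑ ν, (k ν : ℤ)) - k j) := by
    refine Finset.prod_subset (Finset.subset_univ s) fun j _ hjs => ?_
    rw [hns hjs, Nat.cast_zero, sub_zero, div_self (thVar_ne_zero hσ τ j _)]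
  have p3 : ∏ j, thVar σ τ j (1 + ∑ ν, (k ν : ℤ)) / thVar σ τ j (1 + (∑ ν, (k ν : ℤ)) - k j) =
      thVar σ τ i (1 + ∑ ν, (k ν : ℤ)) *
      ∏ j, (if j = i then 1 else thVar σ τ j (1 + ∑ ν, (k ν : ℤ))) /
        thVar σ τ j (1 + (∑ ν, (k ν : ℤ)) - k j) := by
    rw [Finset.prod_div_distrib, Finset.prod_div_distrib, ← mul_div_assoc]
    congr 1
    have hp := Finset.prod_ite_eq' Finset.univ i fun j => thVar σ τ j (1 + ∑ ν, (k ν : ℤ))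
    rw [if_pos (Finset.mem_univ i)] at hp
    rw [← hp, ← Finset.prod_mul_distrib]
    refine Finset.prod_congr rfl fun j _ => ?_
    split_ifs <;> simp
  have hne := thVar_ne_zero hσ τ i (1 + ∑ ν, (k ν : ℤ))
  rw [p1, p2, p3, recursionWeight]
  field_simp

/-- The action of `(∑ X_i) ^ n` on the constant `1`. In the inductive step the summands are
`powerCoeff σ τ k` times the recursion weights, and these add up to `1`. -/
theorem rep_sum_pow {σ : ℂ} (hσ : σ ≠ 0) (τ : ℍ) (n : ℕ)
    (hq : ∀ m, 1 ≤ m → m ≤ n → th τ (qC r σ ^ m) ≠ 0) (k : Fin r → ℕ) :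
    rep hσ τ ((∑ i, X hσ τ i) ^ n) (Pi.single 0 1) k =
      if ∑ i, k i = n then powerCoeff σ τ k else 0 := by
  induction n generalizing k with
  | zero =>
    rw [pow_zero, map_one, Module.End.one_apply]
    by_cases hk : k = 0
    · subst hk
      simp [powerCoeff, powerConstFactor, powerVarFactor, powerRatioFactor, monomialRatioFactor,
        thetaFactorial]
    · rw [Pi.single_eq_of_ne hk, if_neg]
      intro h0
      exact hk (funext fun i => Finset.sum_eq_zero_iff.1 h0 i (Finset.mem_univ i))
  | succ n ih =>
    have ih' := ih fun m h1 h2 => hq m h1 (h2.trans n.le_succ)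
    rw [pow_succ', map_mul, Module.End.mul_apply, map_sum, LinearMap.sum_apply, Finset.sum_apply]
    have hterm (i : Fin r) : rep hσ τ (X hσ τ i)
        (rep hσ τ ((∑ i, X hσ τ i) ^ n) (Pi.single 0 1)) k =
        if ∑ i, k i = n + 1 then powerCoeff σ τ k * recursionWeight σ τ k i else 0 := by
      rw [rep_X, opX_apply, ih']
      by_cases hi : k i = 0
      · rw [if_pos hi, recursionWeight_eq_zero σ τ hi, mul_zero, ite_self]
      · obtain ⟨k', rfl⟩ : ∃ k' : Fin r → ℕ, k = k' + Pi.single i 1 := by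
          refine ⟨k - Pi.single i 1, (tsub_add_cancel_of_le fun l => ?_).symm⟩
          by_cases hl : l = i
          · rw [hl, Pi.single_eq_same]
            exact Nat.one_le_iff_ne_zero.2 hi
          · simp [hl]
        have hs : ∑ ν, (k' + Pi.single i 1 : Fin r → ℕ) ν = ∑ ν, k' ν + 1 := by
          simp [Finset.sum_add_distrib]
        rw [if_neg hi, add_tsub_cancel_right, hs]
        simp only [Nat.add_right_cancel_iff]
        split_ifs with hn
        · refine opCoeff_mul_shiftMer_powerCoeff hσ τ k' i (hq _ (by simp) ?_)
            (hq _ (by simp) (by rw [hn]))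
          rw [← hn]
          exact Nat.succ_le_succ (Finset.single_le_sum (fun _ _ => Nat.zero_le _)
            (Finset.mem_univ i))
        · rw [map_zero, mul_zero]
    rw [Finset.sum_congr rfl fun i _ => hterm i]
    split_ifs with hk
    · rw [← Finset.mul_sum, sum_recursionWeight hσ τ k (by rw [hk]; exact n.succ_pos)
        (by rwa [hk]), mul_one]
    · exact Finset.sum_const_zero

end Expansion

end EllipticMultinomial

theorem theorem3p2 (r n : ℕ) {σ : ℂ} (hσ : σ ≠ 0) (τ : ℍ)
    (hq : ∀ m : ℕ, 1 ≤ m → m ≤ n → ∀ l : ℤ,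
      EllipticMultinomial.base σ ^ m ≠ EllipticMultinomial.nome τ ^ l) :
    (∃ c : (Fin r → ℕ) → EllipticMultinomial.TotallyElliptic r σ τ,
      (∀ k : Fin r → ℕ, ∑ i, k i = n →
        (c k : EllipticMultinomial.Mer r) = EllipticMultinomial.ellMultinomial σ τ k) ∧
      (∑ i, EllipticMultinomial.X hσ τ i) ^ n =
        ∑ k ∈ Finset.piAntidiag (Finset.univ : Finset (Fin r)) n,
          EllipticMultinomial.C hσ τ (c k) * EllipticMultinomial.monomial hσ τ k) ∧
    (∀ x : EllipticMultinomial.EllAlgebra r hσ τ,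
      ∃! f : (Fin r → ℕ) →₀ EllipticMultinomial.TotallyElliptic r σ τ,
        x = f.sum fun k g =>
          EllipticMultinomial.C hσ τ g * EllipticMultinomial.monomial hσ τ k) := by
  open EllipticMultinomial in
  refine ⟨?_, fun x => ?_⟩
  · obtain ⟨f, hf⟩ := exists_normal_form hσ τ ((∑ i, X hσ τ i) ^ n)
    have hth (m : ℕ) (h1 : 1 ≤ m) (h2 : m ≤ n) : th τ (qC r σ ^ m) ≠ 0 :=
      th_qC_pow_ne_zero τ (hq m h1 h2)
    -- the coefficients of the normal form, read off from the action on the constant `1`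
    have hcoeff (k : Fin r → ℕ) : (f k : Mer r) * monomialCoeff σ τ k =
        if ∑ i, k i = n then powerCoeff σ τ k else 0 := by
      rw [← rep_normal_form hσ, ← hf, rep_sum_pow hσ τ n hth]
    refine ⟨f, fun k hk => ?_, ?_⟩
    · refine mul_right_cancel₀ (monomialCoeff_ne_zero hσ τ k) ?_
      rw [hcoeff, if_pos hk, ellMultinomial_mul_monomialCoeff hσ]
    · rw [hf]
      refine Finsupp.sum_of_support_subset _ (fun k hk => ?_) _ fun k _ => by
        rw [map_zero, zero_mul]
      rw [Finset.mem_piAntidiag]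
      refine ⟨?_, fun i _ => Finset.mem_univ i⟩
      by_contra hne
      have h0 := hcoeff k
      rw [if_neg hne] at h0
      exact Finsupp.mem_support_iff.1 hk (Subtype.ext
        ((mul_eq_zero.1 h0).resolve_right (monomialCoeff_ne_zero hσ τ k)))
  · obtain ⟨f, hf⟩ := exists_normal_form hσ τ x
    exact ⟨f, hf, fun g hg => normal_form_injective hσ τ (hg.symm.trans hf)⟩
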